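/- Let $k\ge 1$, $\theta\ge 0$, and let $\alpha_1,\dots,\alpha_k\in\mathbb R$ satisfy $\alpha_1>\alpha_2+1>\cdots>\alpha_k+k-1>k-1$. Write $W_k=\{x\in\mathbb R^k: x_1<\cdots<x_k\}$ and $\overline{W_k}$ for its closure, and for $t>0$ and $x\in\overline{W_k}$ put $$v(t,x)=\frac1{(2\pi i)^k}\int_{(\alpha_1+i\mathbb R)\times\cdots\times(\alpha_k+i\mathbb R)}dz\ \prod_{a<b}\left(\frac{z_a-z_b}{z_a-z_b-1}\,\frac{z_a+z_b-1}{z_a+z_b}\right)\left(\prod_{a=1}^k\frac1{z_a}\right)e^{\frac t2\sum_{a=1}^k(z_a-\theta)^2+\sum_{a=1}^k(z_a-\theta)x_a}.$$ The integral converges absolutely, and $v$ solves the delta Bose gas with tilted half-flat initial condition $v_0(x)=\prod_{a=1}^k e^{-\theta x_a}\mathbf 1_{x_a\ge0}$. That is, $v$ is continuous on $(0,\infty)\times\overline{W_k}$; for each $t>0$ the function $v(t,\cdot)$ is $C^2$ on $W_k$ and $C^1$ on $\overline{W_k}$; and 1. $\partial_t v(t,x)=\frac12\Delta v(t,x)$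 for all $t>0$ and $x\in W_k$, where $\Delta$ is the Laplacian in $x$; 2. $(\partial_{x_a}-\partial_{x_{a+1}}-1)v(t,x)=0$ for all $t>0$, $1\le a<k$ and $x\in\overline{W_k}$ with $x_a=x_{a+1}$, where derivatives at boundary points are taken from within $\overline{W_k}$; 3. $\lim_{t\downarrow0}v(t,x)=v_0(x)$ for all $x\in W_k$ with $x_1\ne0$, that is, at every point of $W_k$ at which $v_0$ is continuous. -/

import Mathlib

open Complex Filter Topology MeasureTheory

noncomputable section

/-- The open Weyl chamber `W_k = {x ∈ ℝ^k : x_1 < x_2 < ⋯ < x_k}`. -/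
def weylChamber (k : ℕ) : Set (EuclideanSpace ℝ (Fin k)) :=
  {x | ∀ a b : Fin k, a < b → x a < x b}

/-- `v` is a classical solution, for times `t > 0`, of the equations of the delta Bose gas:
the heat equation in the open Weyl chamber, with the boundary condition
`(∂_{x_a} - ∂_{x_{a+1}} - 1) v = 0` on every wall `x_a = x_{a+1}`.  At boundary points the values
of `v` are those of its continuous extension to the closed chamber, and the derivative is the
derivative from within the closed chamber (a convex set with nonempty interior, so that the
derivative `L` below is unique). -/
structure IsDeltaBoseSolution (k : ℕ) (v : ℝ → EuclideanSpace ℝ (Fin k) → ℂ) : Prop where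
  continuousOn :
    ContinuousOn (Function.uncurry v) (Set.Ioi (0 : ℝ) ×ˢ closure (weylChamber k))
  contDiffOn_two : ∀ t : ℝ, 0 < t → ContDiffOn ℝ 2 (v t) (weylChamber k)
  contDiffOn_one : ∀ t : ℝ, 0 < t → ContDiffOn ℝ 1 (v t) (closure (weylChamber k))
  heat : ∀ t : ℝ, 0 < t → ∀ x ∈ weylChamber k,
    HasDerivAt (fun s : ℝ => v s x) ((1 / 2 : ℂ) * Laplacian.laplacian (v t) x) t
  boundary : ∀ t : ℝ, 0 < t → ∀ x ∈ closure (weylChamber k),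
    ∀ a b : Fin k, (b : ℕ) = (a : ℕ) + 1 → x a = x b →
      ∃ L : EuclideanSpace ℝ (Fin k) →L[ℝ] ℂ,
        HasFDerivWithinAt (v t) L (closure (weylChamber k)) x ∧
        L (EuclideanSpace.single a 1) - L (EuclideanSpace.single b 1) - v t x = 0

/-- The tilted half-flat initial data `v_0(x) = ∏_a e^{-θ x_a} 1_{x_a ≥ 0}`. -/
def tiltedHalfFlat (k : ℕ) (θ : ℝ) (x : EuclideanSpace ℝ (Fin k)) : ℝ :=
  ∏ a : Fin k, Real.exp (-θ * x a) * Set.indicator (Set.Ici (0 : ℝ)) (fun _ => (1 : ℝ)) (x a)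

/-- The point `α + i y` of the product of vertical lines `α + (iℝ)^k`. -/
def verticalPoint {k : ℕ} (α y : Fin k → ℝ) : Fin k → ℂ :=
  fun a => (α a : ℂ) + (y a : ℂ) * I

/-- The integral `∫_{α + (iℝ)^k} dz f(z)` over upward oriented vertical lines
(`dz_a = i dy_a` in the parametrization `z = α + i y`). -/
def verticalIntegral {k : ℕ} (α : Fin k → ℝ) (f : (Fin k → ℂ) → ℂ) : ℂ :=
  ∫ y : Fin k → ℝ, I ^ k * f (verticalPoint α y)

/-- The integrand of the contour integral formula. -/
def halfFlatIntegrand (k : ℕ) (θ t : ℝ) (x : EuclideanSpace ℝ (Fin k)) (z : Fin k → ℂ) : ℂ :=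
  (∏ a : Fin k, ∏ b ∈ Finset.Ioi a,
      ((z a - z b) / (z a - z b - 1) * ((z a + z b - 1) / (z a + z b)))) *
    (∏ a : Fin k, 1 / z a) *
    Complex.exp ((t : ℂ) / 2 * ∑ a : Fin k, (z a - (θ : ℂ)) ^ 2 +
      ∑ a : Fin k, (z a - (θ : ℂ)) * (x a : ℂ))

/-- The right-hand side of the contour integral formula. -/
def halfFlatFormula (k : ℕ) (θ : ℝ) (α : Fin k → ℝ) (t : ℝ)
    (x : EuclideanSpace ℝ (Fin k)) : ℂ :=
  1 / (2 * (Real.pi : ℂ) * I) ^ k * verticalIntegral α (halfFlatIntegrand k θ t x)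

end

/-!
The integrand depends on `(t, x)` only through the exponential of a linear form in `(t, x)`, and
on the given contours its rational part is bounded, so the integral converges absolutely with
Gaussian decay for `t > 0`. Differentiation under the integral sign (`hasFDerivAt_expIntegral`)
multiplies the integrand by the coefficients of that linear form. This gives smoothness on
`(0, ∞) × ℝ^k`, and the heat equation since both sides multiply the integrand by
`1/2 ∑ (z_a - θ) ^ 2`.

For the boundary condition, the operator `∂_a - ∂_{a+1} - 1` multiplies the integrand by
`z_a - z_{a+1} - 1`, which cancels the only pole met when the contour of `z_a` is moved onto that
of `z_{a+1}`. On equal contours, and for `x_a = x_{a+1}`, the integrand is antisymmetric in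
`z_a, z_{a+1}`, so the integral vanishes (`integral_wall_eq_zero`).

For the initial condition let first `x_1 < 0`. The contour of `z_1` can be moved to `Re z_1 = R` for
any large `R`, and the choice `R = θ - x_1 / t` bounds the integral by a power of `1 / t` times
`exp (-x_1 ^ 2 / (2 t))` (`tendsto_halfFlatFormula_of_neg`). If `x_1 > 0`, all coordinates are
positive and one argues by induction on `k` (`tendsto_halfFlatFormula_of_pos`). The contour of `z_k`
is moved to `Re z_k = θ - x_k / t`, where the integral is again negligible. This crosses simple
poles at `0` and at `-z_j`, `j < k`, which are separated by partial fractions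
(`halfFlatIntegrand_last_eq`, `integral_last_eq`).

* At `z_k = 0` all factors which couple `z_k` to the other variables cancel, and the residue is
  `exp (t θ ^ 2 / 2 - θ x_k)` times the integrand for `k - 1` variables.
* At `z_k = -z_j` the factors coupling `z_k` to `z_i` cancel those coupling `z_j` to `z_i` for
  `i < j`, and what is left has no pole to the right of the contour of `z_j`
  (`reflectedResidue_eq`). As its exponential factor is `exp (t z_j ^ 2 - (x_k - x_j) z_j)`, moving
  `z_j` to the right shows that it vanishes in the limit (`tendsto_integral_reflectedResidue`).

The contour shifts are done one variable at a time, the other variables being held fixed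
(`integral_insertNth_congr`), with the residue theorem for one simple pole between two vertical
lines (`integral_verticalLine_sub_eq_residue`).
-/

/-! ### Moving vertical contours in one variable -/

/-- The closed vertical strip `a ≤ Re z ≤ b`. -/
def verticalStrip (a b : ℝ) : Set ℂ := re ⁻¹' Set.Icc a b

/-- `h` grows at most exponentially in `|Im z|` on the strip `a ≤ Re z ≤ b`. -/
def StripGrowth (a b : ℝ) (h : ℂ → ℂ) : Prop :=
  ∃ C M : ℝ, 0 ≤ C ∧ ∀ z ∈ verticalStrip a b, ‖h z‖ ≤ C * Real.exp (M * |z.im|)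

/-- `g` decays like a Gaussian in `Im z`, up to an exponential factor, on the strip
`a ≤ Re z ≤ b`. -/
def StripDecay (a b : ℝ) (g : ℂ → ℂ) : Prop :=
  ∃ C M c : ℝ, 0 ≤ C ∧ 0 < c ∧ ∀ z ∈ verticalStrip a b,
    ‖g z‖ ≤ C * Real.exp (M * |z.im| - c * z.im ^ 2)

lemma StripGrowth.mul {a b : ℝ} {f h : ℂ → ℂ} (hf : StripGrowth a b f) (hh : StripGrowth a b h) :
    StripGrowth a b (fun z => f z * h z) := by
  obtain ⟨C, M, hC, H⟩ := hf
  obtain ⟨C', M', hC', H'⟩ := hh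
  refine ⟨C * C', M + M', by positivity, fun z hz => ?_⟩
  rw [norm_mul, add_mul, Real.exp_add]
  calc ‖f z‖ * ‖h z‖ ≤ (C * Real.exp (M * |z.im|)) * (C' * Real.exp (M' * |z.im|)) :=
        mul_le_mul (H z hz) (H' z hz) (norm_nonneg _) (by positivity)
    _ = _ := by ring

lemma StripGrowth.mul_decay {a b : ℝ} {f g : ℂ → ℂ} (hf : StripGrowth a b f)
    (hg : StripDecay a b g) : StripDecay a b (fun z => f z * g z) := by
  obtain ⟨C, M, hC, H⟩ := hf
  obtain ⟨C', M', c, hC', hc, H'⟩ := hg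
  refine ⟨C * C', M + M', c, by positivity, hc, fun z hz => ?_⟩
  rw [norm_mul, add_mul, add_sub_assoc, Real.exp_add]
  calc ‖f z‖ * ‖g z‖ ≤ (C * Real.exp (M * |z.im|)) *
        (C' * Real.exp (M' * |z.im| - c * z.im ^ 2)) :=
        mul_le_mul (H z hz) (H' z hz) (norm_nonneg _) (by positivity)
    _ = _ := by ring

lemma StripGrowth.of_bounded {a b : ℝ} {f : ℂ → ℂ} {C : ℝ}
    (h : ∀ z ∈ verticalStrip a b, ‖f z‖ ≤ C) : StripGrowth a b f := by
  refine ⟨|C|, 0, abs_nonneg _, fun z hz => ?_⟩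
  simpa using (h z hz).trans (le_abs_self C)

lemma StripGrowth.prod {a b : ℝ} {ι : Type*} (s : Finset ι) {f : ι → ℂ → ℂ}
    (h : ∀ i ∈ s, StripGrowth a b (f i)) : StripGrowth a b (fun z => ∏ i ∈ s, f i z) := by
  classical
  induction s using Finset.induction_on with
  | empty => exact .of_bounded (C := 1) (by simp)
  | insert i s hi ih =>
    simp only [Finset.prod_insert hi]
    exact (h i (by simp)).mul (ih fun j hj => h j (by simp [hj]))

lemma StripGrowth.sub_const (a b : ℝ) (p : ℂ) : StripGrowth a b (fun z => z - p) := by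
  refine ⟨|a| + |b| + ‖p‖ + 1, 1, by positivity, fun z hz => ?_⟩
  have h1 : |z.re| ≤ |a| + |b| := by
    obtain ⟨h1, h2⟩ := hz
    rw [abs_le]
    constructor <;> linarith [neg_abs_le a, le_abs_self b, abs_nonneg a, abs_nonneg b]
  have h2 := Complex.norm_le_abs_re_add_abs_im z
  have h3 := norm_sub_le z p
  have h4 := Real.add_one_le_exp |z.im|
  have : 0 ≤ |a| + |b| + ‖p‖ := by positivity
  rw [one_mul]
  nlinarith [abs_nonneg z.im]

lemma StripDecay.exp_quadratic (a b : ℝ) {c : ℝ} (hc : 0 < c) (q r : ℝ) :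
    StripDecay a b (fun z => exp (c * z ^ 2 + q * z + r)) := by
  refine ⟨Real.exp (c * (|a| + |b|) ^ 2 + |q| * (|a| + |b|) + r), 0, c, by positivity, hc,
    fun z hz => ?_⟩
  rw [Complex.norm_exp, ← Real.exp_add, Real.exp_le_exp]
  have h1 : |z.re| ≤ |a| + |b| := by
    obtain ⟨h1, h2⟩ := hz
    rw [abs_le]
    constructor <;> linarith [neg_abs_le a, le_abs_self b, abs_nonneg a, abs_nonneg b]
  have h2 : z.re ^ 2 ≤ (|a| + |b|) ^ 2 := by
    rw [← sq_abs z.re]; gcongr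
  have h3 : q * z.re ≤ |q| * (|a| + |b|) := by
    refine (le_abs_self _).trans ?_
    rw [abs_mul]; gcongr
  have : (c * z ^ 2 + q * z + r : ℂ).re = c * (z.re ^ 2 - z.im ^ 2) + q * z.re + r := by
    simp [pow_two]
  rw [this]
  nlinarith

/-- A Gaussian absorbs an exponential. -/
lemma integrable_exp_abs_sub_sq (M : ℝ) {c : ℝ} (hc : 0 < c) :
    Integrable (fun y : ℝ => Real.exp (M * |y| - c * y ^ 2)) := by
  refine Integrable.mono' (g := fun y => Real.exp (M ^ 2 / (2 * c)) * Real.exp (-(c / 2) * y ^ 2))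
    ((integrable_exp_neg_mul_sq (by positivity)).const_mul _) (by fun_prop)
    (ae_of_all _ fun y => ?_)
  rw [Real.norm_eq_abs, Real.abs_exp, ← Real.exp_add, Real.exp_le_exp, ← sub_nonneg]
  have : M ^ 2 / (2 * c) + -(c / 2) * y ^ 2 - (M * |y| - c * y ^ 2)
      = (M - c * |y|) ^ 2 / (2 * c) := by
    field_simp
    rw [← sq_abs y]; ring
  rw [this]; positivity

lemma continuous_verticalLine {a b : ℝ} {g : ℂ → ℂ} (hg : ContinuousOn g (verticalStrip a b))
    {σ : ℝ} (hσ : σ ∈ Set.Icc a b) : Continuous (fun y : ℝ => g (σ + y * I)) :=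
  hg.comp_continuous (by fun_prop) (fun y => by simpa [verticalStrip] using hσ)

lemma StripDecay.integrable {a b : ℝ} {g : ℂ → ℂ} (hg : StripDecay a b g)
    (hc : ContinuousOn g (verticalStrip a b)) {σ : ℝ} (hσ : σ ∈ Set.Icc a b) :
    Integrable (fun y : ℝ => g (σ + y * I)) := by
  obtain ⟨C, M, c, hC, hc', H⟩ := hg
  refine ((integrable_exp_abs_sub_sq M hc').const_mul C).mono'
    (continuous_verticalLine hc hσ).aestronglyMeasurable (ae_of_all _ fun y => ?_)
  simpa using H (σ + y * I) (by simpa [verticalStrip] using hσ)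

lemma StripDecay.bounded {a b : ℝ} {g : ℂ → ℂ} (hg : StripDecay a b g) :
    ∃ C : ℝ, 0 ≤ C ∧ ∀ z ∈ verticalStrip a b, ‖g z‖ ≤ C := by
  obtain ⟨C, M, c, hC, hc', H⟩ := hg
  refine ⟨C * Real.exp (M ^ 2 / (4 * c)), by positivity, fun z hz => (H z hz).trans ?_⟩
  gcongr
  rw [← sub_nonneg]
  have : M ^ 2 / (4 * c) - (M * |z.im| - c * z.im ^ 2) = (M - 2 * c * |z.im|) ^ 2 / (4 * c) := by
    field_simp
    rw [← sq_abs z.im]; ring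
  rw [this]; positivity

lemma integral_inv_verticalLine {β : ℝ} (hβ : β ≠ 0) (T : ℝ) :
    ∫ y in (-T)..T, ((β : ℂ) + y * I)⁻¹ = ((2 * Real.arctan (T / β) : ℝ) : ℂ) := by
  have hpos : ∀ y : ℝ, 0 < β ^ 2 + y ^ 2 := fun y => by positivity
  have hne : ∀ y : ℝ, (β : ℂ) + y * I ≠ 0 := fun y h => hβ (by simpa using congrArg re h)
  have hd : ∀ y ∈ Set.uIcc (-T) T, HasDerivAt
      (fun y : ℝ => ((Real.arctan (y / β) : ℝ) : ℂ) - I / 2 * ((Real.log (β ^ 2 + y ^ 2) : ℝ) : ℂ))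
      (((β : ℂ) + y * I)⁻¹) y := by
    intro y _
    have h1 := (((hasDerivAt_id y).div_const β).arctan).ofReal_comp
    have h2 := ((((hasDerivAt_id y).pow 2).const_add (β ^ 2)).log (hpos y).ne').ofReal_comp
    refine (h1.sub (h2.const_mul (I / 2))).congr_deriv (Eq.symm ?_)
    have e1 : (1 + (y / β) ^ 2 : ℝ) = (β ^ 2 + y ^ 2) / β ^ 2 := by field_simp
    have e2 : ((β ^ 2 + y ^ 2 : ℝ) : ℂ) = (β + y * I) * (β - y * I) := by
      push_cast; linear_combination ((y : ℂ) ^ 2) * I_sq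
    have h3 : ((β ^ 2 + y ^ 2 : ℝ) : ℂ) ≠ 0 := by exact_mod_cast (hpos y).ne'
    have hβ' : (β : ℂ) ≠ 0 := by exact_mod_cast hβ
    simp only [id, Pi.pow_apply, e1]
    rw [inv_eq_of_mul_eq_one_right (b := (β - y * I) / ((β ^ 2 + y ^ 2 : ℝ) : ℂ))
      (by rw [← mul_div_assoc, ← e2, div_self h3])]
    push_cast at h3 ⊢
    field_simp
  rw [intervalIntegral.integral_eq_sub_of_hasDerivAt hd
    ((Continuous.inv₀ (by fun_prop) hne).intervalIntegrable _ _)]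
  simp only [neg_div, Real.arctan_neg, neg_sq]
  push_cast
  ring

lemma tendsto_integral_inv_verticalLine {β : ℝ} (hβ : 0 < β) :
    Tendsto (fun T : ℝ => ∫ y in (-T)..T, ((β : ℂ) + y * I)⁻¹) atTop (𝓝 (Real.pi : ℂ)) := by
  simp only [integral_inv_verticalLine hβ.ne']
  refine (continuous_ofReal.tendsto Real.pi).comp ?_
  have := (Real.tendsto_arctan_atTop.mono_right nhdsWithin_le_nhds).comp
    (tendsto_id.atTop_div_const hβ)
  have h2 := this.const_mul 2
  rw [show 2 * (Real.pi / 2) = Real.pi by ring] at h2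
  exact h2

lemma tendsto_integral_inv_verticalLine_neg {β : ℝ} (hβ : β < 0) :
    Tendsto (fun T : ℝ => ∫ y in (-T)..T, ((β : ℂ) + y * I)⁻¹) atTop (𝓝 (-Real.pi : ℂ)) := by
  have := (tendsto_integral_inv_verticalLine (neg_pos.2 hβ)).neg
  refine this.congr fun T => ?_
  rw [integral_inv_verticalLine hβ.ne, integral_inv_verticalLine (neg_pos.2 hβ).ne', div_neg,
    Real.arctan_neg]
  push_cast; ring

/-- Residue theorem for one simple pole between two vertical lines: `dslope g p` is holomorphic,
so its integral over the boundary of a tall rectangle vanishes; the remaining term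
`g p / (z - p)` is integrated explicitly. -/
theorem integral_verticalLine_sub_eq_residue {a b : ℝ} {g : ℂ → ℂ} {p : ℂ}
    (hg : DifferentiableOn ℂ g (verticalStrip a b)) (hd : StripDecay a b g)
    (hap : a < p.re) (hpb : p.re < b) :
    (∫ y : ℝ, g (b + y * I) / (b + y * I - p)) - ∫ y : ℝ, g (a + y * I) / (a + y * I - p)
      = 2 * Real.pi * g p := by
  have hab : a < b := hap.trans hpb
  have hnhds : verticalStrip a b ∈ 𝓝 p :=
    continuous_re.continuousAt.preimage_mem_nhds (Icc_mem_nhds hap hpb)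
  have hh := (Complex.differentiableOn_dslope hnhds).2 hg
  obtain ⟨C, hC0, hC⟩ := hd.bounded
  have hpS : p ∈ verticalStrip a b := ⟨hap.le, hpb.le⟩
  -- the part of the boundary integral on the vertical line `Re z = σ`
  have key : ∀ σ ∈ Set.Icc a b, σ ≠ p.re → ∀ L : ℂ,
      Tendsto (fun T : ℝ => ∫ y in (-T)..T, (((σ - p.re : ℝ) : ℂ) + y * I)⁻¹) atTop (𝓝 L) →
      Tendsto (fun T : ℝ => ∫ y in (p.im - T)..(p.im + T), dslope g p (σ + y * I)) atTop
        (𝓝 ((∫ y : ℝ, g (σ + y * I) / (σ + y * I - p)) - g p * L)) := by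
    intro σ hσ hne L hL
    have hne' : ∀ y : ℝ, (σ : ℂ) + y * I - p ≠ 0 := fun y h => hne (by
      have := congrArg re h; simp at this; linarith)
    have hgc := continuous_verticalLine hg.continuousOn hσ
    have hlow : ∀ y : ℝ, |σ - p.re| ≤ ‖(σ : ℂ) + y * I - p‖ := fun y => by
      simpa using Complex.abs_re_le_norm ((σ : ℂ) + y * I - p)
    have hint : Integrable (fun y : ℝ => g (σ + y * I) / (σ + y * I - p)) := by
      have hpos : 0 < |σ - p.re| := abs_pos.2 (sub_ne_zero.2 hne)
      refine ((hd.integrable hg.continuousOn hσ).norm.mul_const (|σ - p.re|⁻¹)).mono'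
        (hgc.div (by fun_prop) hne').aestronglyMeasurable (ae_of_all _ fun y => ?_)
      rw [norm_div, div_eq_mul_inv]
      gcongr
      exact hlow y
    have h1 := intervalIntegral_tendsto_integral hint
      (a := fun T : ℝ => p.im - T) (b := fun T : ℝ => p.im + T) (l := atTop)
      (tendsto_atBot_add_const_left _ _ tendsto_neg_atTop_atBot)
      (tendsto_atTop_add_const_left _ _ tendsto_id)
    refine (h1.sub (hL.const_mul (g p))).congr fun T => ?_
    have hshift : ∫ y in (-T)..T, (((σ - p.re : ℝ) : ℂ) + y * I)⁻¹
        = ∫ y in (p.im - T)..(p.im + T), ((σ : ℂ) + y * I - p)⁻¹ := by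
      have := intervalIntegral.integral_comp_sub_right
        (fun y : ℝ => (((σ - p.re : ℝ) : ℂ) + y * I)⁻¹) (a := p.im - T) (b := p.im + T) p.im
      rw [show p.im - T - p.im = -T by ring, show p.im + T - p.im = T by ring] at this
      rw [← this]
      refine intervalIntegral.integral_congr fun y _ => ?_
      congr 1
      push_cast
      linear_combination -(Complex.re_add_im p)
    have i1 : Continuous fun y : ℝ => g (σ + y * I) / (σ + y * I - p) :=
      hgc.div (by fun_prop) hne'
    have i2 : Continuous fun y : ℝ => g p * ((σ : ℂ) + y * I - p)⁻¹ :=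
      continuous_const.mul (Continuous.inv₀ (by fun_prop) hne')
    rw [hshift, ← intervalIntegral.integral_const_mul, ← intervalIntegral.integral_sub
      (i1.intervalIntegrable _ _) (i2.intervalIntegrable _ _)]
    refine intervalIntegral.integral_congr fun y _ => ?_
    rw [dslope_of_ne _ (sub_ne_zero.1 (hne' y)), slope_def_field]
    field_simp
  have hb := key b ⟨hab.le, le_rfl⟩ hpb.ne' Real.pi
    (tendsto_integral_inv_verticalLine (sub_pos.2 hpb))
  have ha := key a ⟨le_rfl, hab.le⟩ hap.ne (-Real.pi)
    (tendsto_integral_inv_verticalLine_neg (sub_neg.2 hap))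
  -- the horizontal sides of the rectangle do not contribute in the limit
  have hor : ∀ s : ℝ → ℝ, (∀ T, |s T - p.im| = |T|) →
      Tendsto (fun T : ℝ => ∫ x in a..b, dslope g p (x + (s T : ℝ) * I)) atTop (𝓝 0) := by
    intro s hs
    have hlim : Tendsto (fun T : ℝ => 2 * C / T * |b - a|) atTop (𝓝 0) := by
      simpa using (tendsto_const_nhds.div_atTop tendsto_id).mul_const |b - a|
    refine squeeze_zero_norm' ?_ hlim
    filter_upwards [eventually_gt_atTop 0] with T hT
    refine intervalIntegral.norm_integral_le_of_norm_le_const fun x hx => ?_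
    rw [Set.uIoc_of_le hab.le] at hx
    have hz : (x : ℂ) + (s T : ℝ) * I ∈ verticalStrip a b := by
      simpa [verticalStrip] using ⟨hx.1.le, hx.2⟩
    have hTle : T ≤ ‖(x : ℂ) + (s T : ℝ) * I - p‖ := by
      have := Complex.abs_im_le_norm ((x : ℂ) + (s T : ℝ) * I - p)
      simp only [sub_im, add_im, ofReal_im, mul_im, ofReal_re, I_im, I_re] at this
      have h2 := hs T
      rw [abs_of_pos hT] at h2
      simpa [h2] using this
    have hne : (x : ℂ) + (s T : ℝ) * I ≠ p := fun h => by
      rw [h, sub_self, norm_zero] at hTle; linarith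
    rw [dslope_of_ne _ hne, slope_def_field, norm_div]
    gcongr
    exact (norm_sub_le _ _).trans (by linarith [hC _ hz, hC _ hpS])
  have hbot := hor (fun T => p.im - T) (fun T => by simp)
  have htop := hor (fun T => p.im + T) (fun T => by simp)
  have hrect : ∀ T : ℝ, ((∫ x in a..b, dslope g p (x + ((p.im - T : ℝ) : ℂ) * I)) -
      (∫ x in a..b, dslope g p (x + ((p.im + T : ℝ) : ℂ) * I)) +
      I • ∫ y in (p.im - T)..(p.im + T), dslope g p (b + y * I)) -
      I • ∫ y in (p.im - T)..(p.im + T), dslope g p (a + y * I) = 0 := by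
    intro T
    have := Complex.integral_boundary_rect_eq_zero_of_differentiableOn (dslope g p)
      ⟨a, p.im - T⟩ ⟨b, p.im + T⟩ (hh.mono fun z hz => by
        have := hz.1
        rw [Set.uIcc_of_le hab.le] at this
        exact this)
    simpa using this
  have hlim := (((hbot.sub htop).add (hb.const_smul I)).sub (ha.const_smul I))
  have := tendsto_nhds_unique (hlim.congr fun T => hrect T) tendsto_const_nhds
  simp only [sub_zero, zero_add, smul_eq_mul] at this
  have := mul_left_cancel₀ I_ne_zero ((sub_eq_zero.1 this).trans (by rfl))
  linear_combination this

/-- Cauchy's theorem for two vertical lines. -/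
theorem integral_verticalLine_eq {a b : ℝ} (hab : a ≤ b) {f : ℂ → ℂ}
    (hf : DifferentiableOn ℂ f (verticalStrip a b)) (hd : StripDecay a b f) :
    (∫ y : ℝ, f (a + y * I)) = ∫ y : ℝ, f (b + y * I) := by
  rcases hab.eq_or_lt with rfl | hab
  · rfl
  -- apply the residue theorem to `f z (z - p) / (z - p)` for some `p` between the lines
  set p : ℂ := (((a + b) / 2 : ℝ) : ℂ) with hp
  have hpre : p.re = (a + b) / 2 := by rw [hp, ofReal_re]
  have h := integral_verticalLine_sub_eq_residue (g := fun z => (z - p) * f z) (p := p) (a := a)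
    (b := b) (by fun_prop) ((StripGrowth.sub_const a b p).mul_decay hd)
    (by rw [hpre]; linarith) (by rw [hpre]; linarith)
  have hne : ∀ σ : ℝ, σ ≠ (a + b) / 2 → ∀ y : ℝ, (σ : ℂ) + y * I - p ≠ 0 := fun σ hσ y h => hσ (by
    have := congrArg re h; simp [hpre] at this; linarith)
  have e : ∀ σ : ℝ, σ ≠ (a + b) / 2 → (∫ y : ℝ, (σ + y * I - p) * f (σ + y * I) / (σ + y * I - p))
      = ∫ y : ℝ, f (σ + y * I) := fun σ hσ => integral_congr_ae (ae_of_all _ fun y => by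
        simp only
        rw [mul_div_cancel_left₀ _ (hne σ hσ y)])
  simp only [e a (by linarith), e b (by linarith), sub_self, zero_mul, mul_zero] at h
  exact (sub_eq_zero.1 h).symm

/-! ### Smoothness of exponential integrals -/

/-- `f : ℝ^k → ℂ` grows at most exponentially in the `ℓ¹` norm. -/
def ExpGrowth {k : ℕ} (f : (Fin k → ℝ) → ℂ) : Prop :=
  ∃ C M : ℝ, 0 ≤ C ∧ ∀ y, ‖f y‖ ≤ C * Real.exp (M * ∑ a, |y a|)

lemma ExpGrowth.mul {k : ℕ} {f g : (Fin k → ℝ) → ℂ} (hf : ExpGrowth f) (hg : ExpGrowth g) :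
    ExpGrowth (fun y => f y * g y) := by
  obtain ⟨C, M, hC, H⟩ := hf
  obtain ⟨C', M', hC', H'⟩ := hg
  refine ⟨C * C', M + M', by positivity, fun y => ?_⟩
  rw [norm_mul, add_mul, Real.exp_add]
  calc ‖f y‖ * ‖g y‖ ≤ (C * Real.exp (M * ∑ a, |y a|)) * (C' * Real.exp (M' * ∑ a, |y a|)) :=
        mul_le_mul (H y) (H' y) (norm_nonneg _) (by positivity)
    _ = _ := by ring

lemma ExpGrowth.of_bounded {k : ℕ} {f : (Fin k → ℝ) → ℂ} {C : ℝ} (h : ∀ y, ‖f y‖ ≤ C) :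
    ExpGrowth f :=
  ⟨|C|, 0, abs_nonneg _, fun y => by simpa using (h y).trans (le_abs_self C)⟩

lemma ExpGrowth.add {k : ℕ} {f g : (Fin k → ℝ) → ℂ} (hf : ExpGrowth f) (hg : ExpGrowth g) :
    ExpGrowth (fun y => f y + g y) := by
  obtain ⟨C, M, hC, H⟩ := hf
  obtain ⟨C', M', hC', H'⟩ := hg
  refine ⟨C + C', |M| + |M'|, by positivity, fun y => ?_⟩
  have hS : 0 ≤ ∑ a, |y a| := Finset.sum_nonneg fun a _ => abs_nonneg _
  have e1 : Real.exp (M * ∑ a, |y a|) ≤ Real.exp ((|M| + |M'|) * ∑ a, |y a|) := by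
    gcongr; linarith [le_abs_self M, abs_nonneg M']
  have e2 : Real.exp (M' * ∑ a, |y a|) ≤ Real.exp ((|M| + |M'|) * ∑ a, |y a|) := by
    gcongr; linarith [le_abs_self M', abs_nonneg M]
  calc ‖f y + g y‖ ≤ ‖f y‖ + ‖g y‖ := norm_add_le _ _
    _ ≤ C * Real.exp (M * ∑ a, |y a|) + C' * Real.exp (M' * ∑ a, |y a|) := add_le_add (H y) (H' y)
    _ ≤ C * Real.exp ((|M| + |M'|) * ∑ a, |y a|) + C' * Real.exp ((|M| + |M'|) * ∑ a, |y a|) := by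
        gcongr
    _ = _ := by ring

lemma ExpGrowth.sum {k : ℕ} {ι : Type*} (s : Finset ι) {f : ι → (Fin k → ℝ) → ℂ}
    (h : ∀ i ∈ s, ExpGrowth (f i)) : ExpGrowth (fun y => ∑ i ∈ s, f i y) := by
  classical
  induction s using Finset.induction_on with
  | empty => exact .of_bounded (C := 0) (by simp)
  | insert i s hi ih =>
    simp only [Finset.sum_insert hi]
    exact (h i (by simp)).add (ih fun j hj => h j (by simp [hj]))

lemma ExpGrowth.verticalPoint_sub {k : ℕ} (α : Fin k → ℝ) (a : Fin k) (c : ℂ) :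
    ExpGrowth (fun y => verticalPoint α y a - c) := by
  refine ⟨‖(α a : ℂ) - c‖ + 1, 1, by positivity, fun y => ?_⟩
  have h1 : ‖verticalPoint α y a - c‖ ≤ ‖(α a : ℂ) - c‖ + |y a| := by
    have : verticalPoint α y a - c = (α a - c) + y a * I := by simp [verticalPoint]; ring
    rw [this]
    refine (norm_add_le _ _).trans ?_
    simp
  have h2 : |y a| ≤ ∑ a, |y a| :=
    Finset.single_le_sum (f := fun a => |y a|) (fun _ _ => abs_nonneg _) (Finset.mem_univ a)
  have h3 := Real.add_one_le_exp (∑ a, |y a|)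
  have h0 := abs_nonneg (y a)
  rw [one_mul]
  nlinarith [norm_nonneg ((α a : ℂ) - c)]

lemma integrable_exp_sum_abs_sub_sq {k : ℕ} (M : ℝ) {c : ℝ} (hc : 0 < c) :
    Integrable (fun y : Fin k → ℝ => Real.exp (M * ∑ a, |y a| - c * ∑ a, y a ^ 2)) := by
  have := Integrable.fintype_prod (ι := Fin k) (μ := fun _ => (volume : Measure ℝ))
    (f := fun _ y => Real.exp (M * |y| - c * y ^ 2)) (fun _ => integrable_exp_abs_sub_sq M hc)
  refine this.congr (ae_of_all _ fun y => ?_)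
  simp only
  rw [← Real.exp_sum, Finset.sum_sub_distrib, Finset.mul_sum, Finset.mul_sum]

/-- The coefficients of the exponent `t/2 ∑ (z_a - θ)^2 + ∑ (z_a - θ) x_a` as a linear form in
`(t, x)`: `none` is the index of `t`, and `some a` that of `x_a`. -/
noncomputable def phaseCoeff {k : ℕ} (θ : ℝ) (α y : Fin k → ℝ) : Option (Fin k) → ℂ
  | none => 1 / 2 * ∑ a, (verticalPoint α y a - θ) ^ 2
  | some a => verticalPoint α y a - θ

/-- The coordinates of `(t, x)`, as complex-valued real-linear forms. -/
noncomputable def phaseCoord (k : ℕ) : Option (Fin k) → (ℝ × EuclideanSpace ℝ (Fin k)) →L[ℝ] ℂ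
  | none => ofRealCLM.comp (ContinuousLinearMap.fst ℝ ℝ _)
  | some a => ofRealCLM.comp ((EuclideanSpace.proj a).comp (ContinuousLinearMap.snd ℝ ℝ _))

/-- The exponent `t/2 ∑ (z_a - θ)^2 + ∑ (z_a - θ) x_a` as a linear form in `(t, x)`. -/
noncomputable def phase {k : ℕ} (θ : ℝ) (α y : Fin k → ℝ) :
    (ℝ × EuclideanSpace ℝ (Fin k)) →L[ℝ] ℂ :=
  ∑ i, phaseCoeff θ α y i • phaseCoord k i

/-- The integral of `A(y) exp (t/2 ∑ (z_a - θ)^2 + ∑ (z_a - θ) x_a)` along `z = α + i y`, as a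
function of `p = (t, x)`. -/
noncomputable def expIntegral {k : ℕ} (θ : ℝ) (α : Fin k → ℝ) (A : (Fin k → ℝ) → ℂ)
    (p : ℝ × EuclideanSpace ℝ (Fin k)) : ℂ :=
  ∫ y, A y * exp (phase θ α y p)

lemma phase_apply {k : ℕ} (θ : ℝ) (α y : Fin k → ℝ) (t : ℝ) (x : EuclideanSpace ℝ (Fin k)) :
    phase θ α y (t, x) = (t : ℂ) / 2 * ∑ a, (verticalPoint α y a - θ) ^ 2 +
      ∑ a, (verticalPoint α y a - θ) * (x a : ℂ) := by
  simp [phase, Fintype.sum_option, phaseCoeff, phaseCoord]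
  ring

lemma phase_re {k : ℕ} (θ : ℝ) (α y : Fin k → ℝ) (t : ℝ) (x : EuclideanSpace ℝ (Fin k)) :
    (phase θ α y (t, x)).re =
      t / 2 * ∑ a, (α a - θ) ^ 2 + ∑ a, (α a - θ) * x a - t / 2 * ∑ a, y a ^ 2 := by
  rw [phase_apply, add_re, re_sum, show (t : ℂ) / 2 = ((t / 2 : ℝ) : ℂ) by push_cast; rfl,
    re_ofReal_mul, re_sum]
  have h1 : ∀ a, ((verticalPoint α y a - θ) ^ 2).re = (α a - θ) ^ 2 - y a ^ 2 := fun a => by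
    simp [verticalPoint, pow_two]
  have h2 : ∀ a, ((verticalPoint α y a - θ) * (x a : ℂ)).re = (α a - θ) * x a := fun a => by
    simp [verticalPoint]
  simp only [h1, h2, Finset.sum_sub_distrib]
  ring

lemma continuous_phaseCoeff {k : ℕ} (θ : ℝ) (α : Fin k → ℝ) (i : Option (Fin k)) :
    Continuous (fun y => phaseCoeff θ α y i) := by
  cases i <;> simp only [phaseCoeff, verticalPoint] <;> fun_prop

lemma continuous_phase {k : ℕ} (θ : ℝ) (α : Fin k → ℝ) : Continuous (fun y => phase θ α y) :=
  continuous_finsetSum _ fun i _ => (continuous_phaseCoeff θ α i).smul continuous_const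

lemma ExpGrowth.phaseCoeff {k : ℕ} (θ : ℝ) (α : Fin k → ℝ) (i : Option (Fin k)) :
    ExpGrowth (fun y => phaseCoeff θ α y i) := by
  cases i with
  | none =>
    simp only [_root_.phaseCoeff, pow_two]
    exact (ExpGrowth.of_bounded (C := ‖(1 / 2 : ℂ)‖) fun _ => le_rfl).mul
      (.sum _ fun a _ => (verticalPoint_sub α a θ).mul (verticalPoint_sub α a θ))
  | some a => exact verticalPoint_sub α a θ

/-- Domination of the integrand, locally uniform in `(t, x)`. -/
lemma ExpGrowth.exists_bound {k : ℕ} {A : (Fin k → ℝ) → ℂ} (hA : ExpGrowth A) (θ : ℝ)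
    (α : Fin k → ℝ) {p₀ : ℝ × EuclideanSpace ℝ (Fin k)} (hp₀ : 0 < p₀.1) :
    ∃ bound : (Fin k → ℝ) → ℝ, Integrable bound ∧ ∀ p ∈ Metric.ball p₀ (p₀.1 / 2), ∀ y,
      ‖A y * exp (phase θ α y p)‖ ≤ bound y := by
  obtain ⟨C, M, hC, H⟩ := hA
  set K := p₀.1 * ∑ a, (α a - θ) ^ 2 + ∑ a, |α a - θ| * (‖p₀.2‖ + p₀.1) with hK
  refine ⟨fun y => C * Real.exp K * Real.exp (M * ∑ a, |y a| - p₀.1 / 4 * ∑ a, y a ^ 2),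
    (integrable_exp_sum_abs_sub_sq M (by positivity)).const_mul _, ?_⟩
  rintro ⟨t, x⟩ hp y
  rw [Metric.mem_ball, Prod.dist_eq, max_lt_iff, Real.dist_eq, abs_lt] at hp
  obtain ⟨⟨ht1, ht2⟩, hx⟩ := hp
  simp only at ht1 ht2 hx
  have hxa : ∀ a, |x a| ≤ ‖p₀.2‖ + p₀.1 := fun a => by
    have h1 := PiLp.norm_apply_le x a
    rw [Real.norm_eq_abs] at h1
    rw [dist_eq_norm] at hx
    linarith [norm_sub_norm_le x p₀.2]
  rw [norm_mul, Complex.norm_exp, phase_re]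
  refine (mul_le_mul_of_nonneg_right (H y) (Real.exp_nonneg _)).trans ?_
  beta_reduce
  rw [mul_assoc, mul_assoc, ← Real.exp_add, ← Real.exp_add]
  refine mul_le_mul_of_nonneg_left (Real.exp_le_exp.2 ?_) hC
  have h1 : t / 2 * ∑ a, (α a - θ) ^ 2 ≤ p₀.1 * ∑ a, (α a - θ) ^ 2 :=
    mul_le_mul_of_nonneg_right (by linarith) (Finset.sum_nonneg fun _ _ => sq_nonneg _)
  have h2 : ∑ a, (α a - θ) * x a ≤ ∑ a, |α a - θ| * (‖p₀.2‖ + p₀.1) := by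
    refine Finset.sum_le_sum fun a _ => (le_abs_self _).trans ?_
    rw [abs_mul]
    exact mul_le_mul_of_nonneg_left (hxa a) (abs_nonneg _)
  have h3 : p₀.1 / 4 * ∑ a, y a ^ 2 ≤ t / 2 * ∑ a, y a ^ 2 :=
    mul_le_mul_of_nonneg_right (by linarith) (Finset.sum_nonneg fun _ _ => sq_nonneg _)
  linarith

lemma aestronglyMeasurable_mul_exp_phase {k : ℕ} {A : (Fin k → ℝ) → ℂ}
    (hm : AEStronglyMeasurable A) (θ : ℝ) (α : Fin k → ℝ) (p : ℝ × EuclideanSpace ℝ (Fin k)) :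
    AEStronglyMeasurable (fun y => A y * exp (phase θ α y p)) :=
  hm.mul (continuous_exp.comp
    ((continuous_phase θ α).clm_apply continuous_const)).aestronglyMeasurable

lemma ExpGrowth.integrable {k : ℕ} {A : (Fin k → ℝ) → ℂ} (hA : ExpGrowth A)
    (hm : AEStronglyMeasurable A) (θ : ℝ) (α : Fin k → ℝ) {p : ℝ × EuclideanSpace ℝ (Fin k)}
    (hp : 0 < p.1) : Integrable (fun y => A y * exp (phase θ α y p)) := by
  obtain ⟨b, hb, H⟩ := hA.exists_bound θ α hp
  exact hb.mono' (aestronglyMeasurable_mul_exp_phase hm θ α p)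
    (ae_of_all _ (H p (Metric.mem_ball_self (by positivity))))

/-- Differentiation under the integral sign: the derivative is again given by integrals of the
same type. -/
theorem hasFDerivAt_expIntegral {k : ℕ} {A : (Fin k → ℝ) → ℂ} (hA : ExpGrowth A)
    (hm : AEStronglyMeasurable A) (θ : ℝ) (α : Fin k → ℝ) {p : ℝ × EuclideanSpace ℝ (Fin k)}
    (hp : 0 < p.1) :
    HasFDerivAt (expIntegral θ α A)
      (∑ i, expIntegral θ α (fun y => A y * phaseCoeff θ α y i) p • phaseCoord k i) p := by
  have hAi : ∀ i, ExpGrowth (fun y => A y * phaseCoeff θ α y i) := fun i =>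
    hA.mul (.phaseCoeff θ α i)
  have hmi : ∀ i, AEStronglyMeasurable (fun y => A y * phaseCoeff θ α y i) := fun i =>
    hm.mul (continuous_phaseCoeff θ α i).aestronglyMeasurable
  choose b hb H using fun i => (hAi i).exists_bound θ α hp
  have key : ∀ (q : ℝ × EuclideanSpace ℝ (Fin k)) (y : Fin k → ℝ),
      (A y * exp (phase θ α y q)) • phase θ α y
        = ∑ i, (A y * phaseCoeff θ α y i * exp (phase θ α y q)) • phaseCoord k i := by
    intro q y
    rw [phase, Finset.smul_sum]
    refine Finset.sum_congr rfl fun i _ => ?_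
    rw [smul_smul]
    congr 1
    ring
  have main := hasFDerivAt_integral_of_dominated_of_fderiv_le (μ := volume) (𝕜 := ℝ)
    (F := fun q y => A y * exp (phase θ α y q))
    (F' := fun q y => (A y * exp (phase θ α y q)) • phase θ α y)
    (bound := fun y => ∑ i, b i y * ‖phaseCoord k i‖) (x₀ := p)
    (Metric.ball_mem_nhds p (half_pos hp))
    (Eventually.of_forall fun q => aestronglyMeasurable_mul_exp_phase hm θ α q)
    (hA.integrable hm θ α hp)
    ((aestronglyMeasurable_mul_exp_phase hm θ α p).smul (continuous_phase θ α).aestronglyMeasurable)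
    (ae_of_all _ fun y q hq => by
      rw [key]
      refine (norm_sum_le _ _).trans (Finset.sum_le_sum fun i _ => ?_)
      rw [norm_smul]
      exact mul_le_mul_of_nonneg_right (H i q hq y) (norm_nonneg _))
    (integrable_finsetSum _ fun i _ => (hb i).mul_const _)
    (ae_of_all _ fun y q hq => by
      have h1 : HasFDerivAt (fun q => exp (phase θ α y q))
          (exp (phase θ α y q) • phase θ α y) q := (phase θ α y).hasFDerivAt.cexp
      have h2 := h1.const_mul (A y)
      rwa [smul_smul] at h2)
  refine main.congr_fderiv ?_
  simp only [key, expIntegral]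
  rw [integral_finsetSum _ fun i _ => ((hAi i).integrable (hmi i) θ α hp).smul_const _]
  exact Finset.sum_congr rfl fun i _ => integral_smul_const _ _

theorem contDiffOn_expIntegral {k : ℕ} (n : ℕ) {A : (Fin k → ℝ) → ℂ} (hA : ExpGrowth A)
    (hm : AEStronglyMeasurable A) (θ : ℝ) (α : Fin k → ℝ) :
    ContDiffOn ℝ n (expIntegral θ α A) {p | 0 < p.1} := by
  have hopen : IsOpen {p : ℝ × EuclideanSpace ℝ (Fin k) | 0 < p.1} :=
    isOpen_lt continuous_const continuous_fst
  induction n generalizing A with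
  | zero =>
    rw [Nat.cast_zero, contDiffOn_zero]
    exact fun p hp => (hasFDerivAt_expIntegral hA hm θ α hp).continuousAt.continuousWithinAt
  | succ n ih =>
    rw [Nat.cast_add, Nat.cast_one, contDiffOn_succ_iff_fderiv_of_isOpen hopen]
    refine ⟨fun p hp => (hasFDerivAt_expIntegral hA hm θ α hp).differentiableAt
      |>.differentiableWithinAt, by simp, ?_⟩
    refine ContDiffOn.congr (f := fun p => ∑ i,
      expIntegral θ α (fun y => A y * phaseCoeff θ α y i) p • phaseCoord k i) ?_
      fun p hp => (hasFDerivAt_expIntegral hA hm θ α hp).fderiv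
    exact ContDiffOn.sum fun i _ => (ih (hA.mul (.phaseCoeff θ α i))
      (hm.mul (continuous_phaseCoeff θ α i).aestronglyMeasurable)).smul contDiffOn_const

/-- The derivative in `x` only, at fixed `t`. -/
lemma hasFDerivAt_expIntegral_space {k : ℕ} {A : (Fin k → ℝ) → ℂ} (hA : ExpGrowth A)
    (hm : AEStronglyMeasurable A) (θ : ℝ) (α : Fin k → ℝ) {t : ℝ} (ht : 0 < t)
    (x : EuclideanSpace ℝ (Fin k)) :
    HasFDerivAt (fun x => expIntegral θ α A (t, x))
      (∑ a, expIntegral θ α (fun y => A y * (verticalPoint α y a - θ)) (t, x) •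
        (ofRealCLM.comp (EuclideanSpace.proj a) : EuclideanSpace ℝ (Fin k) →L[ℝ] ℂ)) x := by
  have h := (hasFDerivAt_expIntegral hA hm θ α (p := (t, x)) ht).comp x
    (hasFDerivAt_prodMk_right t x)
  refine h.congr_fderiv ?_
  ext v
  simp [Fintype.sum_option, phaseCoord, phaseCoeff]

lemma hasDerivAt_expIntegral_time {k : ℕ} {A : (Fin k → ℝ) → ℂ} (hA : ExpGrowth A)
    (hm : AEStronglyMeasurable A) (θ : ℝ) (α : Fin k → ℝ) {t : ℝ} (ht : 0 < t)
    (x : EuclideanSpace ℝ (Fin k)) :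
    HasDerivAt (fun s => expIntegral θ α A (s, x))
      (expIntegral θ α (fun y => A y * (1 / 2 * ∑ a, (verticalPoint α y a - θ) ^ 2)) (t, x)) t := by
  have h := ((hasFDerivAt_expIntegral hA hm θ α (p := (t, x)) ht).comp t
    (hasFDerivAt_prodMk_left t x)).hasDerivAt
  refine h.congr_deriv ?_
  simp [Fintype.sum_option, phaseCoord, phaseCoeff]

lemma laplacian_expIntegral {k : ℕ} {A : (Fin k → ℝ) → ℂ} (hA : ExpGrowth A)
    (hm : AEStronglyMeasurable A) (θ : ℝ) (α : Fin k → ℝ) {t : ℝ} (ht : 0 < t)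
    (x : EuclideanSpace ℝ (Fin k)) :
    Laplacian.laplacian (fun x => expIntegral θ α A (t, x)) x =
      2 * expIntegral θ α (fun y => A y * (1 / 2 * ∑ a, (verticalPoint α y a - θ) ^ 2)) (t, x) := by
  have hAi : ∀ a, ExpGrowth (fun y => A y * (verticalPoint α y a - θ)) := fun i =>
    hA.mul (.verticalPoint_sub α i θ)
  have hmi : ∀ a, AEStronglyMeasurable (fun y => A y * (verticalPoint α y a - θ)) := fun a =>
    hm.mul (continuous_phaseCoeff θ α (some a)).aestronglyMeasurable
  have hAii : ∀ a, ExpGrowth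
      (fun y => A y * (verticalPoint α y a - θ) * (verticalPoint α y a - θ)) := fun i =>
    (hAi i).mul (.verticalPoint_sub α i θ)
  have hmii : ∀ a, AEStronglyMeasurable
      (fun y => A y * (verticalPoint α y a - θ) * (verticalPoint α y a - θ)) := fun a =>
    (hmi a).mul (continuous_phaseCoeff θ α (some a)).aestronglyMeasurable
  have h1 : fderiv ℝ (fun x => expIntegral θ α A (t, x)) = fun x =>
      ∑ a, expIntegral θ α (fun y => A y * (verticalPoint α y a - θ)) (t, x) •
        (ofRealCLM.comp (EuclideanSpace.proj a) : EuclideanSpace ℝ (Fin k) →L[ℝ] ℂ) :=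
    funext fun x => (hasFDerivAt_expIntegral_space hA hm θ α ht x).fderiv
  have h2 := HasFDerivAt.fun_sum (u := Finset.univ) fun a _ =>
    (hasFDerivAt_expIntegral_space (hAi a) (hmi a) θ α ht x).smul_const
      (ofRealCLM.comp (EuclideanSpace.proj a) : EuclideanSpace ℝ (Fin k) →L[ℝ] ℂ)
  rw [InnerProductSpace.laplacian_eq_iteratedFDeriv_orthonormalBasis _
    (EuclideanSpace.basisFun (Fin k) ℝ)]
  simp only [iteratedFDeriv_two_apply, h1, h2.fderiv]
  simp only [EuclideanSpace.basisFun_apply, Matrix.cons_val_zero, Matrix.cons_val_one]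
  have h3 : ∀ b : Fin k, (((∑ a, (∑ c, expIntegral θ α (fun y => A y * (verticalPoint α y a - θ) *
      (verticalPoint α y c - θ)) (t, x) • (ofRealCLM.comp (EuclideanSpace.proj c) :
      EuclideanSpace ℝ (Fin k) →L[ℝ] ℂ)).smulRight (ofRealCLM.comp (EuclideanSpace.proj a) :
      EuclideanSpace ℝ (Fin k) →L[ℝ] ℂ)) (EuclideanSpace.single b 1)) (EuclideanSpace.single b 1))
      = expIntegral θ α (fun y => A y * (verticalPoint α y b - θ) *
        (verticalPoint α y b - θ)) (t, x) := by
    intro b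
    simp [apply_ite]
  rw [Finset.sum_congr rfl fun b _ => h3 b]
  simp only [expIntegral]
  rw [← integral_finsetSum _ fun a _ => (hAii a).integrable (hmii a) θ α ht, ← integral_const_mul]
  refine integral_congr_ae (ae_of_all _ fun y => ?_)
  simp only
  rw [← Finset.sum_mul, ← mul_assoc]
  congr 1
  have : 2 * (A y * (1 / 2 * ∑ a, (verticalPoint α y a - θ) ^ 2))
      = A y * ∑ a, (verticalPoint α y a - θ) ^ 2 := by ring
  rw [this, Finset.mul_sum]
  exact Finset.sum_congr rfl fun a _ => by ring

/-! ### The integrand: factorization and bounds -/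

/-- The interaction of two variables in the integrand. -/
noncomputable def crossFactor (p q : ℂ) : ℂ := (p - q) / (p - q - 1) * ((p + q - 1) / (p + q))

/-- The dependence of the integrand on a single variable, apart from interactions. -/
noncomputable def oneBodyFactor (θ t x : ℝ) (w : ℂ) : ℂ :=
  1 / w * exp ((t : ℂ) / 2 * (w - θ) ^ 2 + (w - θ) * x)

/-- The rational part of the integrand, which does not depend on `(t, x)`. -/
noncomputable def rationalPart {k : ℕ} (z : Fin k → ℂ) : ℂ :=
  (∏ a, ∏ b ∈ Finset.Ioi a, crossFactor (z a) (z b)) * ∏ a, 1 / z a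

/-- The point `x` with its `j`-th coordinate removed. -/
noncomputable def dropCoord {n : ℕ} (j : Fin (n + 1)) (x : EuclideanSpace ℝ (Fin (n + 1))) :
    EuclideanSpace ℝ (Fin n) := WithLp.toLp 2 fun i => x (j.succAbove i)

/-- A product over pairs `a < b`, with the pairs that contain the index `j` split off. -/
lemma prod_Ioi_insertNth {n : ℕ} (c : ℂ → ℂ → ℂ) (j : Fin (n + 1)) (w : ℂ) (u : Fin n → ℂ) :
    (∏ a, ∏ b ∈ Finset.Ioi a, c (j.insertNth (α := fun _ => ℂ) w u a)
        (j.insertNth (α := fun _ => ℂ) w u b)) =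
      (∏ a, ∏ b ∈ Finset.Ioi a, c (u a) (u b)) *
        ∏ i, if j.succAbove i < j then c (u i) w else c w (u i) := by
  have h : ∀ (m : ℕ) (f : Fin m → Fin m → ℂ) (a : Fin m),
      ∏ b ∈ Finset.Ioi a, f a b = ∏ b, if a < b then f a b else 1 := fun m f a => by
    rw [← Finset.prod_filter]
    congr 1
    ext; simp
  simp only [h _ (fun a b => c (j.insertNth (α := fun _ => ℂ) w u a)
    (j.insertNth (α := fun _ => ℂ) w u b)), h _ (fun a b => c (u a) (u b))]
  rw [Fin.prod_univ_succAbove _ j]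
  simp only [Fin.prod_univ_succAbove (fun b => ite _ _ _) j, Fin.insertNth_apply_same,
    Fin.insertNth_apply_succAbove, lt_irrefl, if_false, one_mul, Fin.succAbove_lt_succAbove_iff]
  rw [Finset.prod_mul_distrib, ← mul_assoc, mul_comm, ← Finset.prod_mul_distrib]
  congr 1
  refine Finset.prod_congr rfl fun i _ => ?_
  rcases lt_or_gt_of_ne (Fin.succAbove_ne j i) with h | h
  · simp [h, h.not_gt]
  · simp [h, h.not_gt]

/-- Separating one variable from the others in the integrand. -/
lemma halfFlatIntegrand_insertNth {n : ℕ} (θ t : ℝ) (x : EuclideanSpace ℝ (Fin (n + 1)))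
    (j : Fin (n + 1)) (w : ℂ) (u : Fin n → ℂ) :
    halfFlatIntegrand (n + 1) θ t x (j.insertNth (α := fun _ => ℂ) w u) =
      halfFlatIntegrand n θ t (dropCoord j x) u *
        ((∏ i, if j.succAbove i < j then crossFactor (u i) w else crossFactor w (u i)) *
          oneBodyFactor θ t (x j) w) := by
  have h := prod_Ioi_insertNth crossFactor j w u
  simp only [crossFactor] at h
  simp only [halfFlatIntegrand, crossFactor, oneBodyFactor, h]
  rw [Fin.prod_univ_succAbove _ j, Fin.sum_univ_succAbove _ j, Fin.sum_univ_succAbove _ j]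
  simp only [Fin.insertNth_apply_same, Fin.insertNth_apply_succAbove, dropCoord]
  have e : ∀ A B C D : ℂ, (t : ℂ) / 2 * (A + B) + (C + D) = (t / 2 * B + D) + (t / 2 * A + C) :=
    fun A B C D => by ring
  rw [e, Complex.exp_add]
  ring

lemma halfFlatIntegrand_eq {k : ℕ} (θ t : ℝ) (x : EuclideanSpace ℝ (Fin k)) (α y : Fin k → ℝ) :
    halfFlatIntegrand k θ t x (verticalPoint α y) =
      rationalPart (verticalPoint α y) * exp (phase θ α y (t, x)) := by
  rw [phase_apply]; rfl

lemma verticalPoint_insertNth {n : ℕ} (j : Fin (n + 1)) (β s : ℝ) (α u : Fin n → ℝ) :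
    verticalPoint (j.insertNth (α := fun _ => ℝ) β α) (j.insertNth (α := fun _ => ℝ) s u) =
      j.insertNth (α := fun _ => ℂ) ((β : ℂ) + s * I) (verticalPoint α u) := by
  ext i
  refine Fin.succAboveCases j ?_ (fun i => ?_) i <;> simp [verticalPoint]

lemma continuous_verticalPoint {k : ℕ} (α : Fin k → ℝ) : Continuous (verticalPoint α) := by
  unfold verticalPoint; fun_prop

lemma measurable_rationalPart {k : ℕ} : Measurable (rationalPart (k := k)) := by
  unfold rationalPart crossFactor
  refine Measurable.mul ?_ ?_
  · exact Finset.measurable_prod _ fun a _ => Finset.measurable_prod _ fun b _ => by fun_prop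
  · exact Finset.measurable_prod _ fun a _ => by fun_prop

lemma measurable_halfFlatIntegrand {k : ℕ} (θ t : ℝ) (x : EuclideanSpace ℝ (Fin k)) :
    Measurable (halfFlatIntegrand k θ t x) := by
  have : halfFlatIntegrand k θ t x = fun z => rationalPart z *
      Complex.exp ((t : ℂ) / 2 * ∑ a : Fin k, (z a - (θ : ℂ)) ^ 2 +
      ∑ a : Fin k, (z a - (θ : ℂ)) * (x a : ℂ)) := rfl
  rw [this]
  exact measurable_rationalPart.mul (by fun_prop)

/-- The lines `Re z_a = α_a` stay at distance `δ` from all poles of the integrand. -/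
structure Separated {k : ℕ} (δ : ℝ) (α : Fin k → ℝ) : Prop where
  pos : 0 < δ
  le_sub : ∀ a b, a < b → δ ≤ |α a - α b - 1|
  le_add : ∀ a b, a < b → δ ≤ |α a + α b|
  le_self : ∀ a, δ ≤ |α a|

lemma norm_div_add_one_le {δ : ℝ} (hδ : 0 < δ) {p q c : ℂ} (hpq : ‖p - q‖ ≤ ‖c‖) (h : δ ≤ |q.re|) :
    ‖p / q‖ ≤ 1 + ‖c‖ / δ := by
  have hq : δ ≤ ‖q‖ := h.trans (Complex.abs_re_le_norm q)
  have hq0 : q ≠ 0 := norm_pos_iff.1 (hδ.trans_le hq)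
  have : p / q = 1 + (p - q) / q := by field_simp; ring
  rw [this]
  refine (norm_add_le _ _).trans ?_
  rw [norm_one, norm_div]
  gcongr

lemma norm_crossFactor_le {δ : ℝ} (hδ : 0 < δ) {p q : ℂ} (h1 : δ ≤ |p.re - q.re - 1|)
    (h2 : δ ≤ |p.re + q.re|) : ‖crossFactor p q‖ ≤ (1 + 1 / δ) * (1 + 1 / δ) := by
  rw [crossFactor, norm_mul]
  have e1 := norm_div_add_one_le hδ (p := p - q) (q := p - q - 1) (c := 1) (by simp) (by simpa)
  have e2 := norm_div_add_one_le hδ (p := p + q - 1) (q := p + q) (c := 1) (by simp) (by simpa)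
  rw [norm_one] at e1 e2
  exact mul_le_mul e1 e2 (norm_nonneg _) (by positivity)

/-- A bound for `rationalPart`. -/
noncomputable def rationalBound (k : ℕ) (δ : ℝ) : ℝ :=
  (∏ a : Fin k, ∏ _b ∈ Finset.Ioi a, (1 + 1 / δ) * (1 + 1 / δ)) * ∏ _a : Fin k, 1 / δ

lemma Separated.norm_rationalPart_le {k : ℕ} {δ : ℝ} {α : Fin k → ℝ} (h : Separated δ α)
    (y : Fin k → ℝ) : ‖rationalPart (verticalPoint α y)‖ ≤ rationalBound k δ := by
  have hδ := h.pos
  rw [rationalPart, norm_mul, norm_prod, norm_prod, rationalBound]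
  refine mul_le_mul ?_ ?_ (by positivity) (by positivity)
  · refine Finset.prod_le_prod (fun _ _ => norm_nonneg _) fun a _ => ?_
    rw [norm_prod]
    refine Finset.prod_le_prod (fun _ _ => norm_nonneg _) fun b hb => ?_
    have hab : a < b := Finset.mem_Ioi.1 hb
    exact norm_crossFactor_le hδ (by simpa [verticalPoint] using h.le_sub a b hab)
      (by simpa [verticalPoint] using h.le_add a b hab)
  · refine Finset.prod_le_prod (fun _ _ => norm_nonneg _) fun a _ => ?_
    rw [norm_div, norm_one]
    refine one_div_le_one_div_of_le hδ ((h.le_self a).trans ?_)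
    simpa [verticalPoint] using Complex.abs_re_le_norm (verticalPoint α y a)

lemma Separated.norm_halfFlatIntegrand_le {k : ℕ} {δ : ℝ} {α : Fin k → ℝ} (h : Separated δ α)
    (θ t : ℝ) (x : EuclideanSpace ℝ (Fin k)) (y : Fin k → ℝ) :
    ‖halfFlatIntegrand k θ t x (verticalPoint α y)‖ ≤
      rationalBound k δ * Real.exp (t / 2 * ∑ a, (α a - θ) ^ 2 + ∑ a, (α a - θ) * x a) *
        Real.exp (-(t / 2) * ∑ a, y a ^ 2) := by
  rw [halfFlatIntegrand_eq, norm_mul, Complex.norm_exp, phase_re, mul_assoc, ← Real.exp_add]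
  have e : t / 2 * ∑ a, (α a - θ) ^ 2 + ∑ a, (α a - θ) * x a - t / 2 * ∑ a, y a ^ 2
      = t / 2 * ∑ a, (α a - θ) ^ 2 + ∑ a, (α a - θ) * x a + -(t / 2) * ∑ a, y a ^ 2 := by ring
  rw [e]
  exact mul_le_mul_of_nonneg_right (h.norm_rationalPart_le y) (Real.exp_nonneg _)

lemma Separated.expGrowth {k : ℕ} {δ : ℝ} {α : Fin k → ℝ} (h : Separated δ α) :
    ExpGrowth (fun y => rationalPart (verticalPoint α y)) := .of_bounded h.norm_rationalPart_le

lemma aestronglyMeasurable_rationalPart {k : ℕ} (α : Fin k → ℝ) :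
    AEStronglyMeasurable (fun y => rationalPart (verticalPoint α y)) :=
  (measurable_rationalPart.comp (continuous_verticalPoint α).measurable).aestronglyMeasurable

lemma Separated.integrable_halfFlatIntegrand {k : ℕ} {δ : ℝ} {α : Fin k → ℝ} (h : Separated δ α)
    (θ : ℝ) {t : ℝ} (ht : 0 < t) (x : EuclideanSpace ℝ (Fin k)) :
    Integrable (fun y : Fin k → ℝ => halfFlatIntegrand k θ t x (verticalPoint α y)) := by
  simp only [halfFlatIntegrand_eq]
  exact h.expGrowth.integrable (aestronglyMeasurable_rationalPart α) θ α (p := (t, x)) ht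

lemma integrable_gaussian_pi (k : ℕ) {c : ℝ} (hc : 0 < c) :
    Integrable (fun y : Fin k → ℝ => Real.exp (-c * ∑ a, y a ^ 2)) := by
  simpa using integrable_exp_sum_abs_sub_sq (k := k) 0 hc

lemma integral_gaussian_pi (k : ℕ) (c : ℝ) :
    ∫ y : Fin k → ℝ, Real.exp (-c * ∑ a, y a ^ 2) = √(Real.pi / c) ^ k := by
  have := integral_fintype_prod_volume_eq_prod (𝕜 := ℝ) (ι := Fin k)
    (fun (_ : Fin k) (y : ℝ) => Real.exp (-c * y ^ 2))
  simp only [integral_gaussian, ← Real.exp_sum, ← Finset.mul_sum] at this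
  simpa using this

lemma norm_integral_le_of_gaussian {k : ℕ} {f : (Fin k → ℝ) → ℂ} {K c : ℝ} (hc : 0 < c)
    (h : ∀ y, ‖f y‖ ≤ K * Real.exp (-c * ∑ a, y a ^ 2)) :
    ‖∫ y, f y‖ ≤ K * √(Real.pi / c) ^ k := by
  rw [← integral_gaussian_pi, ← integral_const_mul]
  exact norm_integral_le_of_norm_le ((integrable_gaussian_pi k hc).const_mul K) (ae_of_all _ h)

lemma halfFlatFormula_eq (k : ℕ) (θ : ℝ) (α : Fin k → ℝ) (t : ℝ) (x : EuclideanSpace ℝ (Fin k)) :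
    halfFlatFormula k θ α t x =
      1 / (2 * (Real.pi : ℂ)) ^ k * ∫ y, halfFlatIntegrand k θ t x (verticalPoint α y) := by
  have : I ^ k ≠ 0 := pow_ne_zero _ I_ne_zero
  rw [halfFlatFormula, verticalIntegral, integral_const_mul, mul_pow _ I, ← mul_assoc]
  congr 1
  field_simp

lemma halfFlatFormula_eq_expIntegral (k : ℕ) (θ : ℝ) (α : Fin k → ℝ) (t : ℝ)
    (x : EuclideanSpace ℝ (Fin k)) :
    halfFlatFormula k θ α t x =
      1 / (2 * (Real.pi : ℂ)) ^ k *
        expIntegral θ α (fun y => rationalPart (verticalPoint α y)) (t, x) := by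
  rw [halfFlatFormula_eq]
  simp only [halfFlatIntegrand_eq, expIntegral]

/-! ### Integrating out one variable -/

lemma measurePreserving_insertNth {n : ℕ} (j : Fin (n + 1)) :
    MeasurePreserving (fun p : ℝ × (Fin n → ℝ) => j.insertNth (α := fun _ => ℝ) p.1 p.2) := by
  have := (volume_preserving_piFinSuccAbove (fun _ : Fin (n + 1) => ℝ) j).symm
  exact this

lemma integrable_insertNth {n : ℕ} (j : Fin (n + 1)) {f : (Fin (n + 1) → ℝ) → ℂ}
    (hf : Integrable f) :
    Integrable (fun p : ℝ × (Fin n → ℝ) => f (j.insertNth (α := fun _ => ℝ) p.1 p.2)) :=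
  (measurePreserving_insertNth j).integrable_comp_of_integrable hf

lemma integral_eq_integral_insertNth {n : ℕ} (j : Fin (n + 1)) {f : (Fin (n + 1) → ℝ) → ℂ}
    (hf : Integrable f) :
    ∫ y, f y = ∫ u : Fin n → ℝ, ∫ s : ℝ, f (j.insertNth (α := fun _ => ℝ) s u) := by
  have h1 := (measurePreserving_insertNth j).integral_comp
    (MeasurableEquiv.piFinSuccAbove (fun _ : Fin (n + 1) => ℝ) j).symm.measurableEmbedding f
  rw [← h1]
  exact integral_prod_symm _ (integrable_insertNth j hf)

/-- Moving the contour of one variable, all others being held fixed. -/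
lemma integral_insertNth_congr {n : ℕ} (j : Fin (n + 1)) {β β' : ℝ} (α : Fin n → ℝ)
    {F : (Fin (n + 1) → ℂ) → ℂ}
    (h : Integrable fun y => F (verticalPoint (j.insertNth (α := fun _ => ℝ) β α) y))
    (h' : Integrable fun y => F (verticalPoint (j.insertNth (α := fun _ => ℝ) β' α) y))
    (H : ∀ u : Fin n → ℝ,
      ∫ s : ℝ, F (j.insertNth (α := fun _ => ℂ) ((β : ℂ) + s * I) (verticalPoint α u)) =
      ∫ s : ℝ, F (j.insertNth (α := fun _ => ℂ) ((β' : ℂ) + s * I) (verticalPoint α u))) :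
    ∫ y, F (verticalPoint (j.insertNth (α := fun _ => ℝ) β α) y) =
      ∫ y, F (verticalPoint (j.insertNth (α := fun _ => ℝ) β' α) y) := by
  rw [integral_eq_integral_insertNth j h, integral_eq_integral_insertNth j h']
  simp only [verticalPoint_insertNth, H]

/-! ### Factors of the integrand on a strip -/

/-- `f` is holomorphic, of at most exponential growth in `|Im z|`, on the strip `a ≤ Re z ≤ b`. -/
structure StripRegular (a b : ℝ) (f : ℂ → ℂ) : Prop where
  diff : DifferentiableOn ℂ f (verticalStrip a b)
  growth : StripGrowth a b f

/-- `f` is holomorphic, with Gaussian decay in `Im z`, on the strip `a ≤ Re z ≤ b`. -/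
structure StripGaussian (a b : ℝ) (f : ℂ → ℂ) : Prop where
  diff : DifferentiableOn ℂ f (verticalStrip a b)
  decay : StripDecay a b f

lemma StripRegular.mul {a b : ℝ} {f g : ℂ → ℂ} (hf : StripRegular a b f)
    (hg : StripRegular a b g) : StripRegular a b (fun w => f w * g w) :=
  ⟨hf.diff.mul hg.diff, hf.growth.mul hg.growth⟩

lemma StripRegular.mul_gaussian {a b : ℝ} {f g : ℂ → ℂ} (hf : StripRegular a b f)
    (hg : StripGaussian a b g) : StripGaussian a b (fun w => f w * g w) :=
  ⟨hf.diff.mul hg.diff, hf.growth.mul_decay hg.decay⟩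

lemma StripRegular.const (a b : ℝ) (c : ℂ) : StripRegular a b (fun _ => c) :=
  ⟨differentiableOn_const _, .of_bounded fun _ _ => le_rfl⟩

lemma StripRegular.sub_const (a b : ℝ) (c : ℂ) : StripRegular a b (fun w => w - c) :=
  ⟨by fun_prop, .sub_const a b c⟩

lemma StripRegular.prod {a b : ℝ} {ι : Type*} (s : Finset ι) {f : ι → ℂ → ℂ}
    (h : ∀ i ∈ s, StripRegular a b (f i)) : StripRegular a b (fun z => ∏ i ∈ s, f i z) :=
  ⟨DifferentiableOn.fun_finsetProd fun i hi => (h i hi).diff, .prod s fun i hi => (h i hi).growth⟩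

lemma StripRegular.inv_sub {a b : ℝ} {d : ℂ} (hd : d.re < a ∨ b < d.re) :
    StripRegular a b (fun w => (w - d)⁻¹) := by
  obtain ⟨δ, hδ, h⟩ : ∃ δ : ℝ, 0 < δ ∧ ∀ w ∈ verticalStrip a b, δ ≤ ‖w - d‖ := by
    rcases hd with hd | hd
    · refine ⟨a - d.re, by linarith, fun w hw => le_trans ?_ (Complex.abs_re_le_norm _)⟩
      rw [sub_re]
      exact le_trans (by linarith [hw.1]) (le_abs_self _)
    · refine ⟨d.re - b, by linarith, fun w hw => le_trans ?_ (Complex.abs_re_le_norm _)⟩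
      rw [sub_re, abs_sub_comm]
      exact le_trans (by linarith [hw.2]) (le_abs_self _)
  refine ⟨DifferentiableOn.inv (by fun_prop) fun w hw => norm_pos_iff.1 (hδ.trans_le (h w hw)),
    .of_bounded (C := δ⁻¹) fun w hw => ?_⟩
  rw [norm_inv]
  exact inv_anti₀ hδ (h w hw)

lemma StripRegular.ratio {a b : ℝ} (c : ℂ) {d : ℂ} (hd : d.re < a ∨ b < d.re) :
    StripRegular a b (fun w => (w - c) / (w - d)) := by
  simpa only [div_eq_mul_inv] using (StripRegular.sub_const a b c).mul (.inv_sub hd)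

lemma crossFactor_eq_left (p w : ℂ) : crossFactor p w =
    (w - p) / (w - (p - 1)) * ((w - (1 - p)) / (w - -p)) := by
  rw [crossFactor, ← neg_div_neg_eq]
  congr 2 <;> ring

lemma crossFactor_eq_right (w p : ℂ) : crossFactor w p =
    (w - p) / (w - (p + 1)) * ((w - (1 - p)) / (w - -p)) := by
  rw [crossFactor]
  congr 2 <;> ring

lemma StripRegular.crossFactor_left {a b : ℝ} {p : ℂ} (h1 : b + 1 < p.re) (h2 : -p.re < a) :
    StripRegular a b (fun w => crossFactor p w) := by
  simp only [crossFactor_eq_left]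
  exact (ratio _ (Or.inr (by simp; linarith))).mul (ratio _ (Or.inl (by simp; linarith)))

lemma StripRegular.crossFactor_right {a b : ℝ} {p : ℂ} (h1 : p.re + 1 < a) (h2 : -p.re < a) :
    StripRegular a b (fun w => crossFactor w p) := by
  simp only [crossFactor_eq_right]
  exact (ratio _ (Or.inl (by simp; linarith))).mul (ratio _ (Or.inl (by simp; linarith)))

lemma StripGaussian.exp (a b θ x : ℝ) {t : ℝ} (ht : 0 < t) :
    StripGaussian a b (fun w => exp ((t : ℂ) / 2 * (w - θ) ^ 2 + (w - θ) * x)) := by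
  refine ⟨by fun_prop, ?_⟩
  convert StripDecay.exp_quadratic a b (half_pos ht) (x - t * θ) (t / 2 * θ ^ 2 - θ * x) using 3
  push_cast; ring

lemma StripGaussian.oneBodyFactor {a : ℝ} (b θ x : ℝ) {t : ℝ} (ha : 0 < a) (ht : 0 < t) :
    StripGaussian a b (oneBodyFactor θ t x) := by
  have h := (StripRegular.inv_sub (a := a) (b := b) (d := 0) (Or.inl (by simpa))).mul_gaussian
    (.exp a b θ x ht)
  simp only [sub_zero, ← one_div] at h
  exact h

/-! ### The boundary condition -/

lemma Separated.exists_of_ne {k : ℕ} {α : Fin k → ℝ} (h1 : ∀ a b, a < b → α a - α b - 1 ≠ 0)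
    (h2 : ∀ a b, a < b → α a + α b ≠ 0) (h3 : ∀ a, α a ≠ 0) : ∃ δ, Separated δ α := by
  let f : Fin k × Fin k → ℝ := fun p =>
    min (if p.1 < p.2 then min |α p.1 - α p.2 - 1| |α p.1 + α p.2| else 1) |α p.1|
  have hf : ∀ p, 0 < f p := fun p => by
    refine lt_min ?_ (abs_pos.2 (h3 _))
    split_ifs with h
    · exact lt_min (abs_pos.2 (h1 _ _ h)) (abs_pos.2 (h2 _ _ h))
    · exact one_pos
  obtain ⟨δ, hδ, H⟩ : ∃ δ > 0, ∀ p, δ ≤ f p := by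
    rcases isEmpty_or_nonempty (Fin k × Fin k) with h | h
    · exact ⟨1, one_pos, fun p => h.elim p⟩
    · obtain ⟨p, hp⟩ := Finite.exists_min f
      exact ⟨f p, hf p, hp⟩
  refine ⟨δ, hδ, fun a b hab => ?_, fun a b hab => ?_, fun a => ?_⟩
  · refine (H (a, b)).trans ((min_le_left _ _).trans ?_)
    simp [hab]
  · refine (H (a, b)).trans ((min_le_left _ _).trans ?_)
    simp [hab]
  · exact (H (a, a)).trans (min_le_right _ _)

/-- The admissible contours: `α_a > α_b + 1` for `a < b`, and `α_a > 0`. -/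
structure Admissible {k : ℕ} (α : Fin k → ℝ) : Prop where
  gap : ∀ a b, a < b → α b + 1 < α a
  pos : ∀ a, 0 < α a

lemma Admissible.exists_separated {k : ℕ} {α : Fin k → ℝ} (h : Admissible α) :
    ∃ δ, Separated δ α :=
  Separated.exists_of_ne (fun a b hab => by linarith [h.gap a b hab])
    (fun a b _ => by linarith [h.pos a, h.pos b]) (fun a => (h.pos a).ne')

/-- The integrand in terms of two neighbouring variables `w`, `s` and the others, at a point of
the wall: only the factor `crossFactor w s` is not symmetric in `w`, `s`. -/
lemma halfFlatIntegrand_insertNth_insertNth {m : ℕ} (θ t : ℝ)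
    (x : EuclideanSpace ℝ (Fin (m + 2))) (i : Fin (m + 1)) (hx : x i.castSucc = x i.succ)
    (w s : ℂ) (v : Fin m → ℂ) :
    halfFlatIntegrand (m + 2) θ t x (i.castSucc.insertNth (α := fun _ => ℂ) w
      (i.insertNth (α := fun _ => ℂ) s v)) =
      crossFactor w s * (halfFlatIntegrand m θ t (dropCoord i (dropCoord i.castSucc x)) v *
        (((∏ l, if i.succAbove l < i then crossFactor (v l) s else crossFactor s (v l)) *
          oneBodyFactor θ t (x i.succ) s) *
        ((∏ l, if i.succAbove l < i then crossFactor (v l) w else crossFactor w (v l)) *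
          oneBodyFactor θ t (x i.succ) w))) := by
  rw [halfFlatIntegrand_insertNth, halfFlatIntegrand_insertNth, Fin.prod_univ_succAbove _ i]
  have h1 : (dropCoord i.castSucc x) i = x i.succ := by simp [dropCoord]
  have h2 : ¬ i.castSucc.succAbove i < i.castSucc := by
    rw [Fin.succAbove_lt_iff_castSucc_lt]; exact lt_irrefl _
  have h3 : ∀ l, i.castSucc.succAbove (i.succAbove l) < i.castSucc ↔ i.succAbove l < i :=
    fun l => by
      rw [Fin.succAbove_lt_iff_castSucc_lt, Fin.castSucc_lt_castSucc_iff]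
  simp only [Fin.insertNth_apply_same, Fin.insertNth_apply_succAbove, h1, h2, h3, if_false, hx]
  ring

lemma insertNth_insertNth_swap {m : ℕ} (i : Fin (m + 1)) (w s : ℂ) (v : Fin m → ℂ) :
    (i.castSucc.insertNth (α := fun _ => ℂ) w (i.insertNth (α := fun _ => ℂ) s v)) ∘
        Equiv.swap i.castSucc i.succ =
      i.castSucc.insertNth (α := fun _ => ℂ) s (i.insertNth (α := fun _ => ℂ) w v) := by
  have hs : i.succ = i.castSucc.succAbove i := by simp
  rw [hs]
  funext l
  refine Fin.succAboveCases i.castSucc ?_ (fun l => ?_) l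
  · simp [Equiv.swap_apply_left, -Fin.succAbove_castSucc_self]
  · refine Fin.succAboveCases i ?_ (fun l => ?_) l
    · simp [Equiv.swap_apply_right, -Fin.succAbove_castSucc_self]
    · rw [Function.comp_apply, Equiv.swap_apply_of_ne_of_ne (Fin.succAbove_ne _ _)
        (fun h => Fin.succAbove_ne i l (Fin.succAbove_right_injective h))]
      simp

/-- Once multiplied by `z_a - z_{a+1} - 1`, the integrand at a point of the wall
`x_a = x_{a+1}` is antisymmetric in `z_a`, `z_{a+1}`. -/
lemma mul_halfFlatIntegrand_swap {m : ℕ} (θ t : ℝ) (x : EuclideanSpace ℝ (Fin (m + 2)))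
    (i : Fin (m + 1)) (hx : x i.castSucc = x i.succ) (z : Fin (m + 2) → ℂ)
    (h1 : z i.castSucc - z i.succ - 1 ≠ 0) (h2 : z i.succ - z i.castSucc - 1 ≠ 0) :
    (z i.succ - z i.castSucc - 1) *
        halfFlatIntegrand (m + 2) θ t x (z ∘ Equiv.swap i.castSucc i.succ) =
      -((z i.castSucc - z i.succ - 1) * halfFlatIntegrand (m + 2) θ t x z) := by
  have hz : z = i.castSucc.insertNth (α := fun _ => ℂ) (z i.castSucc)
      (i.insertNth (α := fun _ => ℂ) (z i.succ) (i.removeNth (i.castSucc.removeNth z))) := by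
    rw [show z i.succ = (i.castSucc.removeNth z) i by simp [Fin.removeNth],
      Fin.insertNth_self_removeNth, Fin.insertNth_self_removeNth]
  generalize z i.castSucc = w at *
  generalize z i.succ = s at *
  generalize i.removeNth (i.castSucc.removeNth z) = v at *
  rw [hz, insertNth_insertNth_swap, halfFlatIntegrand_insertNth_insertNth θ t x i hx,
    halfFlatIntegrand_insertNth_insertNth θ t x i hx]
  have e : ∀ p q R : ℂ, p - q - 1 ≠ 0 →
      (p - q - 1) * (crossFactor p q * R) = (p - q) * ((p + q - 1) / (p + q)) * R :=
    fun p q R h => by rw [crossFactor, ← mul_assoc, ← mul_assoc, mul_div_cancel₀ _ h]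
  rw [e s w _ h2, e w s _ h1, add_comm s w]
  ring

lemma integral_comp_swap {k : ℕ} (a b : Fin k) (f : (Fin k → ℝ) → ℂ) :
    ∫ y, f (y ∘ Equiv.swap a b) = ∫ y, f y := by
  have h := volume_measurePreserving_piCongrLeft (fun _ : Fin k => ℝ) (Equiv.swap a b)
  rw [← h.integral_comp (MeasurableEquiv.measurableEmbedding _) f]
  refine integral_congr_ae (ae_of_all _ fun y => ?_)
  simp only
  congr 1
  funext l
  obtain ⟨l', rfl⟩ := (Equiv.swap a b).surjective l
  rw [MeasurableEquiv.coe_piCongrLeft, Equiv.piCongrLeft_apply_apply]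
  simp

lemma aestronglyMeasurable_wall {k : ℕ} (α : Fin k → ℝ) (a b : Fin k) : AEStronglyMeasurable
    (fun y => (verticalPoint α y a - verticalPoint α y b - 1) *
      rationalPart (verticalPoint α y)) := by
  refine AEStronglyMeasurable.mul (Continuous.aestronglyMeasurable ?_)
    (aestronglyMeasurable_rationalPart α)
  unfold verticalPoint; fun_prop

lemma expGrowth_wall {k : ℕ} {δ : ℝ} {α : Fin k → ℝ} (h : Separated δ α) (a b : Fin k) : ExpGrowth
    (fun y => (verticalPoint α y a - verticalPoint α y b - 1) *
      rationalPart (verticalPoint α y)) := by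
  refine ExpGrowth.mul ?_ h.expGrowth
  have h1 := (ExpGrowth.verticalPoint_sub α a 1).add ((ExpGrowth.of_bounded (k := k)
    (f := fun _ => (-1 : ℂ)) (C := 1) (by simp)).mul (ExpGrowth.verticalPoint_sub α b 0))
  convert h1 using 2
  ring

lemma integrable_wall {k : ℕ} {δ : ℝ} {α : Fin k → ℝ} (h : Separated δ α) (a b : Fin k)
    (θ : ℝ) {t : ℝ} (ht : 0 < t) (x : EuclideanSpace ℝ (Fin k)) :
    Integrable (fun y => (verticalPoint α y a - verticalPoint α y b - 1) *
      halfFlatIntegrand k θ t x (verticalPoint α y)) := by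
  simp only [halfFlatIntegrand_eq, ← mul_assoc]
  exact (expGrowth_wall h a b).integrable (aestronglyMeasurable_wall α a b) θ α (p := (t, x)) ht

/-- On the wall `x_a = x_{a+1}`, the factor `z_a - z_{a+1} - 1` removes the pole between the
contours of `z_a` and `z_{a+1}`, so that the two contours can be made equal; then the
integrand is antisymmetric. -/
theorem integral_wall_eq_zero {m : ℕ} {α : Fin (m + 2) → ℝ} (hα : Admissible α) (θ : ℝ) {t : ℝ}
    (ht : 0 < t) (x : EuclideanSpace ℝ (Fin (m + 2))) (i : Fin (m + 1))
    (hx : x i.castSucc = x i.succ) :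
    ∫ y, (verticalPoint α y i.castSucc - verticalPoint α y i.succ - 1) *
      halfFlatIntegrand (m + 2) θ t x (verticalPoint α y) = 0 := by
  have hlt : i.castSucc < i.succ := Fin.castSucc_lt_succ
  have hg := hα.gap _ _ hlt
  set α₀ := i.castSucc.removeNth α with hα₀
  set α' : Fin (m + 2) → ℝ := i.castSucc.insertNth (α := fun _ => ℝ) (α i.succ) α₀ with hα'
  have hαe : i.castSucc.insertNth (α := fun _ => ℝ) (α i.castSucc) α₀ = α :=
    Fin.insertNth_self_removeNth _ _
  have hsucc : ∀ l, α₀ l = α (i.castSucc.succAbove l) := fun l => rfl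
  have h'a : α' i.castSucc = α i.succ := by simp [hα']
  have h'b : α' i.succ = α i.succ := by
    rw [show i.succ = i.castSucc.succAbove i by simp, hα', Fin.insertNth_apply_succAbove, hsucc]
  have h'o : ∀ l, l ≠ i.castSucc → α' l = α l := fun l hl => by
    obtain ⟨l, rfl⟩ := Fin.exists_succAbove_eq hl
    rw [hα', Fin.insertNth_apply_succAbove, hsucc]
  have hpos' : ∀ l, 0 < α' l := fun l => by
    by_cases hl : l = i.castSucc
    · rw [hl, h'a]; exact hα.pos _
    · rw [h'o l hl]; exact hα.pos _
  obtain ⟨δ, hδ⟩ := hα.exists_separated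
  obtain ⟨δ', hδ'⟩ : ∃ δ, Separated δ α' := by
    refine Separated.exists_of_ne (fun a b hab => ?_) (fun a b _ => by linarith [hpos' a, hpos' b])
      (fun a => (hpos' a).ne')
    by_cases ha : a = i.castSucc
    · subst ha
      rw [h'a, h'o b hab.ne']
      rcases (Fin.castSucc_lt_iff_succ_le.1 hab).eq_or_lt with rfl | hb
      · simp
      · linarith [hα.gap _ _ hb]
    · by_cases hb : b = i.castSucc
      · subst hb
        rw [h'a, h'o a ha]
        linarith [hα.gap _ _ (hab.trans hlt)]
      · rw [h'o a ha, h'o b hb]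
        linarith [hα.gap _ _ hab]
  have shift := integral_insertNth_congr i.castSucc (β := α i.castSucc) (β' := α i.succ) α₀
    (F := fun z => (z i.castSucc - z i.succ - 1) * halfFlatIntegrand (m + 2) θ t x z)
    (by rw [hαe]; exact integrable_wall hδ _ _ θ ht x) (integrable_wall hδ' _ _ θ ht x) (by
      intro u
      set U := verticalPoint α₀ u with hU
      have hUre : ∀ l, (U l).re = α (i.castSucc.succAbove l) := fun l => by
        simp [hU, verticalPoint, hsucc]
      have hUi : (U i).re = α i.succ := by rw [hUre]; simp
      -- the integrand with the pole at `w = U i + 1` removed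
      let f : ℂ → ℂ := fun w => halfFlatIntegrand (m + 1) θ t (dropCoord i.castSucc x) U *
        (w - U i) * ((w - (1 - U i)) / (w - -U i)) *
        (∏ l, if i.castSucc.succAbove (i.succAbove l) < i.castSucc
          then crossFactor (U (i.succAbove l)) w else crossFactor w (U (i.succAbove l))) *
        oneBodyFactor θ t (x i.castSucc) w
      have hf : StripGaussian (α i.succ) (α i.castSucc) f := by
        have hp := hα.pos i.succ
        refine StripRegular.mul_gaussian (.mul (.mul (.mul (.const _ _ _) (.sub_const _ _ _))
          (.ratio _ (Or.inl ?_))) (.prod _ fun l _ => ?_)) (.oneBodyFactor _ _ _ hp ht)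
        · rw [neg_re, hUi]; linarith
        · have hp' := hα.pos (i.castSucc.succAbove (i.succAbove l))
          split_ifs with h
          · refine .crossFactor_left ?_ ?_
            · rw [hUre]; exact hα.gap _ _ h
            · rw [hUre]; linarith
          · have h2 : i.succ < i.castSucc.succAbove (i.succAbove l) := by
              refine lt_of_le_of_ne (Fin.castSucc_lt_iff_succ_le.1
                (lt_of_le_of_ne (not_lt.1 h) (Fin.succAbove_ne _ _).symm)) fun he => ?_
              rw [show i.succ = i.castSucc.succAbove i by simp] at he
              exact Fin.succAbove_ne i l (Fin.succAbove_right_injective he).symm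
            refine .crossFactor_right ?_ ?_
            · rw [hUre]; exact hα.gap _ _ h2
            · rw [hUre]; linarith
      have heq : ∀ w : ℂ, w - U i - 1 ≠ 0 →
          (i.castSucc.insertNth (α := fun _ => ℂ) w U i.castSucc -
            i.castSucc.insertNth (α := fun _ => ℂ) w U i.succ - 1) *
            halfFlatIntegrand (m + 2) θ t x (i.castSucc.insertNth (α := fun _ => ℂ) w U) = f w := by
        intro w hw
        have h2 : ¬ i.castSucc.succAbove i < i.castSucc := by
          rw [Fin.succAbove_lt_iff_castSucc_lt]; exact lt_irrefl _
        rw [show i.castSucc.insertNth (α := fun _ => ℂ) w U i.succ = U i by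
          rw [show i.succ = i.castSucc.succAbove i by simp, Fin.insertNth_apply_succAbove],
          Fin.insertNth_apply_same, halfFlatIntegrand_insertNth, Fin.prod_univ_succAbove _ i,
          if_neg h2, crossFactor_eq_right w (U i)]
        have hw' : w - (U i + 1) ≠ 0 := by rwa [← sub_sub]
        simp only [f]
        field_simp
        ring
      have hne : ∀ σ : ℝ, σ ≠ α i.succ + 1 → ∀ s : ℝ, (σ : ℂ) + s * I - U i - 1 ≠ 0 := by
        intro σ hσ s h
        apply hσ
        have := congrArg re h
        simp [hUi] at this
        linarith
      have := integral_verticalLine_eq (by linarith) hf.diff hf.decay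
      simp only [heq _ (hne _ hg.ne' _), heq _ (hne (α i.succ) (by linarith) _), this])
  rw [hαe] at shift
  rw [shift]
  have hsw : α' ∘ Equiv.swap i.castSucc i.succ = α' := by
    funext l
    simp only [Function.comp, Equiv.swap_apply_def]
    split_ifs with h h
    · rw [h, h'a, h'b]
    · rw [h, h'a, h'b]
    · rfl
  have hvp : ∀ y, verticalPoint α' (y ∘ Equiv.swap i.castSucc i.succ) =
      verticalPoint α' y ∘ Equiv.swap i.castSucc i.succ := fun y => by
    funext l
    simp only [verticalPoint, Function.comp]
    rw [← congrFun hsw l]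
    rfl
  have key := integral_comp_swap i.castSucc i.succ (fun y =>
    (verticalPoint α' y i.castSucc - verticalPoint α' y i.succ - 1) *
      halfFlatIntegrand (m + 2) θ t x (verticalPoint α' y))
  have hne : ∀ (y : Fin (m + 2) → ℝ) (a b : Fin (m + 2)), α' a = α' b →
      verticalPoint α' y a - verticalPoint α' y b - 1 ≠ 0 := fun y a b hab h => by
    have := congrArg re h
    simp [verticalPoint, hab] at this
  have hanti : ∀ y, (verticalPoint α' (y ∘ Equiv.swap i.castSucc i.succ) i.castSucc -
      verticalPoint α' (y ∘ Equiv.swap i.castSucc i.succ) i.succ - 1) *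
      halfFlatIntegrand (m + 2) θ t x (verticalPoint α' (y ∘ Equiv.swap i.castSucc i.succ)) =
      -((verticalPoint α' y i.castSucc - verticalPoint α' y i.succ - 1) *
      halfFlatIntegrand (m + 2) θ t x (verticalPoint α' y)) := fun y => by
    rw [hvp, ← mul_halfFlatIntegrand_swap θ t x i hx _ (hne y _ _ (h'a.trans h'b.symm))
      (hne y _ _ (h'b.trans h'a.symm))]
    simp
  simp only [hanti, integral_neg] at key
  exact self_eq_neg.1 key.symm

/-- The contour integral solves the equations of the delta Bose gas. -/
theorem isDeltaBoseSolution_halfFlatFormula {k : ℕ} (θ : ℝ) {α : Fin k → ℝ} (hα : Admissible α) :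
    IsDeltaBoseSolution k (halfFlatFormula k θ α) := by
  obtain ⟨δ, hδ⟩ := hα.exists_separated
  set c : ℂ := 1 / (2 * (Real.pi : ℂ)) ^ k with hc
  set A : (Fin k → ℝ) → ℂ := fun y => c * rationalPart (verticalPoint α y) with hA_def
  have hA : ExpGrowth A :=
    (ExpGrowth.of_bounded (f := fun _ => c) fun _ => le_rfl).mul hδ.expGrowth
  have hm : AEStronglyMeasurable A := (aestronglyMeasurable_rationalPart α).const_mul c
  have hv : ∀ t, halfFlatFormula k θ α t = fun x => expIntegral θ α A (t, x) := fun t =>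
    funext fun x => by
      rw [halfFlatFormula_eq_expIntegral, expIntegral, ← integral_const_mul]
      simp only [expIntegral, hA_def, mul_assoc]
      rfl
  have hsmooth : ∀ (n : ℕ) (t : ℝ), 0 < t → ContDiff ℝ n (halfFlatFormula k θ α t) := by
    intro n t ht
    rw [hv, ← contDiffOn_univ]
    exact (contDiffOn_expIntegral n hA hm θ α).comp (g := expIntegral θ α A)
      (f := fun x => (t, x)) (contDiff_prodMk_right t).contDiffOn fun x _ => ht
  refine ⟨?_, fun t ht => (hsmooth 2 t ht).contDiffOn, fun t ht => (hsmooth 1 t ht).contDiffOn,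
    fun t ht x _ => ?_, ?_⟩
  · refine ((contDiffOn_expIntegral 0 hA hm θ α).continuousOn.mono fun p hp => hp.1).congr ?_
    rintro ⟨t, x⟩ -
    simp [Function.uncurry, hv]
  · simp only [hv]
    rw [laplacian_expIntegral hA hm θ α ht, ← mul_assoc, one_div_mul_cancel two_ne_zero, one_mul]
    exact hasDerivAt_expIntegral_time hA hm θ α ht x
  · intro t ht x _ a b hab hx
    have hL := hasFDerivAt_expIntegral_space hA hm θ α ht x
    rw [← hv] at hL
    refine ⟨_, hL.hasFDerivWithinAt, ?_⟩
    obtain ⟨m, rfl⟩ : ∃ m, k = m + 2 := ⟨k - 2, by have := b.2; omega⟩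
    obtain ⟨i, rfl, rfl⟩ : ∃ i : Fin (m + 1), a = i.castSucc ∧ b = i.succ :=
      ⟨⟨a, by have := b.2; omega⟩, by ext; rfl, by ext; simpa using hab⟩
    have hz := integral_wall_eq_zero hα θ ht x i hx
    have hd : ∀ l : Fin (m + 2), Integrable (fun y => A y * (verticalPoint α y l - θ) *
        exp (phase θ α y (t, x))) := fun l =>
      (hA.mul (.verticalPoint_sub α l θ)).integrable
        (hm.mul (continuous_phaseCoeff θ α (some l)).aestronglyMeasurable) θ α (p := (t, x)) ht
    have hsum : expIntegral θ α (fun y => A y * (verticalPoint α y i.castSucc - θ)) (t, x) -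
        expIntegral θ α (fun y => A y * (verticalPoint α y i.succ - θ)) (t, x) -
        expIntegral θ α A (t, x) = 0 := by
      rw [← mul_zero c, ← hz, ← integral_const_mul]
      simp only [expIntegral]
      have h1 := integral_sub (hd i.castSucc) (hd i.succ)
      have h2 := integral_sub ((hd i.castSucc).sub (hd i.succ))
        (hA.integrable hm θ α (p := (t, x)) ht)
      rw [← h1]
      refine h2.symm.trans (integral_congr_ae (ae_of_all _ fun y => ?_))
      simp only [halfFlatIntegrand_eq, hA_def, Pi.sub_apply]
      ring
    rw [hv]
    simpa [apply_ite] using hsum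

/-! ### The initial condition when the first coordinate is negative -/

lemma tendsto_sqrt_pow_mul_exp (n : ℕ) {c : ℝ} (hc : 0 < c) :
    Tendsto (fun t : ℝ => Real.exp (-c / t) * √(Real.pi / (t / 2)) ^ n) (𝓝[>] 0) (𝓝 0) := by
  have h := (tendsto_rpow_mul_exp_neg_mul_atTop_nhds_zero ((n : ℝ) / 2) c hc).const_mul
    (√(2 * Real.pi) ^ n)
  rw [mul_zero] at h
  refine (h.comp tendsto_inv_nhdsGT_zero).congr' ?_
  filter_upwards [self_mem_nhdsWithin] with t ht
  have ht : 0 < t := ht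
  have e1 : Real.pi / (t / 2) = 2 * Real.pi * t⁻¹ := by field_simp
  have e2 : (t⁻¹) ^ ((n : ℝ) / 2) = √(t⁻¹) ^ n := by
    rw [Real.sqrt_eq_rpow, ← Real.rpow_natCast, ← Real.rpow_mul (by positivity)]
    congr 1; ring
  simp only [Function.comp]
  have e3 : √(2 * Real.pi * t⁻¹) = √(2 * Real.pi) * √t⁻¹ := Real.sqrt_mul (by positivity) _
  rw [e1, e3, mul_pow, e2, div_eq_mul_inv (-c) t]
  ring

lemma tendsto_zero_of_norm_le (n : ℕ) {c K : ℝ} (hc : 0 < c) {f : ℝ → ℂ}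
    (h : ∀ᶠ t in 𝓝[>] 0, ‖f t‖ ≤ K * (Real.exp (-c / t) * √(Real.pi / (t / 2)) ^ n)) :
    Tendsto f (𝓝[>] 0) (𝓝 0) := by
  refine squeeze_zero_norm' h ?_
  simpa using (tendsto_sqrt_pow_mul_exp n hc).const_mul K

/-- The integral over contours of which the `j`-th one is `Re z_j = R`, for times `t ≤ 1`; the
dependence on `R` is explicit. -/
lemma norm_integral_insertNth_le {n : ℕ} {δ : ℝ} (j : Fin (n + 1)) (α : Fin n → ℝ) (R : ℝ)
    (h : Separated δ (j.insertNth (α := fun _ => ℝ) R α)) (θ : ℝ) {t : ℝ} (ht : 0 < t)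
    (ht1 : t ≤ 1) (x : EuclideanSpace ℝ (Fin (n + 1))) :
    ‖∫ y, halfFlatIntegrand (n + 1) θ t x
        (verticalPoint (j.insertNth (α := fun _ => ℝ) R α) y)‖ ≤
      rationalBound (n + 1) δ *
        Real.exp (∑ i, (α i - θ) ^ 2 + ∑ i, (α i - θ) * x (j.succAbove i)) *
        (Real.exp (t / 2 * (R - θ) ^ 2 + (R - θ) * x j) * √(Real.pi / (t / 2)) ^ (n + 1)) := by
  have hb : 0 ≤ rationalBound (n + 1) δ := (norm_nonneg _).trans (h.norm_rationalPart_le 0)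
  rw [← mul_assoc]
  refine norm_integral_le_of_gaussian (half_pos ht) fun y =>
    (h.norm_halfFlatIntegrand_le θ t x y).trans ?_
  refine mul_le_mul_of_nonneg_right ?_ (Real.exp_nonneg _)
  rw [mul_assoc, ← Real.exp_add]
  refine mul_le_mul_of_nonneg_left (Real.exp_le_exp.2 ?_) hb
  rw [Fin.sum_univ_succAbove _ j, Fin.sum_univ_succAbove _ j]
  simp only [Fin.insertNth_apply_same, Fin.insertNth_apply_succAbove]
  have hS : 0 ≤ ∑ i, (α i - θ) ^ 2 := Finset.sum_nonneg fun _ _ => sq_nonneg _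
  nlinarith

/-- If `x_1 < 0`, the contour of `z_1` can be moved to the right without crossing a pole. -/
theorem tendsto_halfFlatFormula_of_neg {n : ℕ} (θ : ℝ) {α : Fin (n + 1) → ℝ} (hα : Admissible α)
    (x : EuclideanSpace ℝ (Fin (n + 1))) (hx : x 0 < 0) :
    Tendsto (fun t => halfFlatFormula (n + 1) θ α t x) (𝓝[>] 0) (𝓝 0) := by
  obtain ⟨δ, hδ⟩ := hα.exists_separated
  set α₀ := (0 : Fin (n + 1)).removeNth α with hα₀
  have hαe : (0 : Fin (n + 1)).insertNth (α := fun _ => ℝ) (α 0) α₀ = α :=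
    Fin.insertNth_self_removeNth _ _
  have hs : ∀ l, α₀ l = α l.succ := fun l => rfl
  have hsep : ∀ R, α 0 ≤ R →
      Separated δ ((0 : Fin (n + 1)).insertNth (α := fun _ => ℝ) R α₀) := by
    intro R hR
    have hp := hδ.pos
    have h0 := hδ.le_self 0
    rw [abs_of_pos (hα.pos 0)] at h0
    refine ⟨hp, fun a b hab => ?_, fun a b hab => ?_, fun a => ?_⟩
    · obtain ⟨b, rfl⟩ := Fin.exists_succ_eq.2 (Fin.ne_zero_of_lt hab)
      have hb : (0 : Fin (n + 1)).insertNth (α := fun _ => ℝ) R α₀ b.succ = α b.succ := by simp [hs]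
      rw [hb]
      rcases Fin.eq_zero_or_eq_succ a with rfl | ⟨a, rfl⟩
      · rw [Fin.insertNth_apply_same]
        have h1 := hδ.le_sub _ _ hab
        rw [abs_of_pos (by linarith [hα.gap _ _ hab])] at h1
        exact le_trans (by linarith) (le_abs_self _)
      · have ha : (0 : Fin (n + 1)).insertNth (α := fun _ => ℝ) R α₀ a.succ = α a.succ := by
          simp [hs]
        rw [ha]
        exact hδ.le_sub _ _ hab
    · obtain ⟨b, rfl⟩ := Fin.exists_succ_eq.2 (Fin.ne_zero_of_lt hab)
      have hb : (0 : Fin (n + 1)).insertNth (α := fun _ => ℝ) R α₀ b.succ = α b.succ := by simp [hs]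
      rw [hb]
      rcases Fin.eq_zero_or_eq_succ a with rfl | ⟨a, rfl⟩
      · rw [Fin.insertNth_apply_same]
        exact le_trans (by linarith [hα.pos b.succ]) (le_abs_self _)
      · have ha : (0 : Fin (n + 1)).insertNth (α := fun _ => ℝ) R α₀ a.succ = α a.succ := by
          simp [hs]
        rw [ha]
        exact hδ.le_add _ _ hab
    · rcases Fin.eq_zero_or_eq_succ a with rfl | ⟨a, rfl⟩
      · rw [Fin.insertNth_apply_same]
        exact le_trans (by linarith) (le_abs_self _)
      · have ha : (0 : Fin (n + 1)).insertNth (α := fun _ => ℝ) R α₀ a.succ = α a.succ := by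
          simp [hs]
        rw [ha]
        exact hδ.le_self _
  have shift : ∀ t, 0 < t → ∀ R, α 0 ≤ R →
      ∫ y, halfFlatIntegrand (n + 1) θ t x (verticalPoint α y) =
      ∫ y, halfFlatIntegrand (n + 1) θ t x
        (verticalPoint ((0 : Fin (n + 1)).insertNth (α := fun _ => ℝ) R α₀) y) := by
    intro t ht R hR
    have := integral_insertNth_congr 0 (β := α 0) (β' := R) α₀
      (F := halfFlatIntegrand (n + 1) θ t x)
      (by rw [hαe]; exact hδ.integrable_halfFlatIntegrand θ ht x)
      ((hsep R hR).integrable_halfFlatIntegrand θ ht x) (by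
        intro u
        simp only [halfFlatIntegrand_insertNth, Fin.not_lt_zero, if_false]
        have hf : StripGaussian (α 0) R (fun w => halfFlatIntegrand n θ t (dropCoord 0 x)
            (verticalPoint α₀ u) * ((∏ i, crossFactor w (verticalPoint α₀ u i)) *
              oneBodyFactor θ t (x 0) w)) := by
          refine (StripRegular.const _ _ _).mul_gaussian (StripRegular.mul_gaussian
            (.prod _ fun i _ => ?_) (.oneBodyFactor _ _ _ (hα.pos 0) ht))
          have hre : (verticalPoint α₀ u i).re = α i.succ := by simp [verticalPoint, hs]
          refine .crossFactor_right ?_ ?_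
          · rw [hre]; exact hα.gap _ _ (Fin.succ_pos i)
          · rw [hre]; linarith [hα.pos 0, hα.pos i.succ]
        exact integral_verticalLine_eq hR hf.diff hf.decay)
    rwa [hαe] at this
  refine tendsto_zero_of_norm_le (n + 1) (c := x 0 ^ 2 / 2)
    (K := ‖(1 / (2 * (Real.pi : ℂ)) ^ (n + 1))‖ * (rationalBound (n + 1) δ *
      Real.exp (∑ i, (α₀ i - θ) ^ 2 +
      ∑ i, (α₀ i - θ) * x ((0 : Fin (n + 1)).succAbove i)))) (by have := hx.ne; positivity) ?_
  have hlarge : ∀ᶠ t : ℝ in 𝓝[>] 0, α 0 ≤ θ + (-x 0) * t⁻¹ :=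
    (tendsto_atTop_add_const_left _ _
      (tendsto_inv_nhdsGT_zero.const_mul_atTop (neg_pos.2 hx))).eventually_ge_atTop _
  have hone : ∀ᶠ t : ℝ in 𝓝[>] 0, t ≤ 1 :=
    nhdsWithin_le_nhds (eventually_le_nhds one_pos)
  filter_upwards [self_mem_nhdsWithin, hlarge, hone] with t ht hR ht1
  have ht : 0 < t := ht
  -- the minimum of `t / 2 * (R - θ) ^ 2 + (R - θ) * x 0` is attained at `R = θ - x 0 / t`
  rw [halfFlatFormula_eq, shift t ht _ hR, norm_mul, mul_assoc]
  refine mul_le_mul_of_nonneg_left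
    ((norm_integral_insertNth_le 0 α₀ _ (hsep _ hR) θ ht ht1 x).trans_eq ?_) (norm_nonneg _)
  congr 3
  field_simp
  ring

/-! ### Partial fractions -/

/-- The residue at `w = -U_j` of `1/w ∏ (U_i + w - 1) / (U_i + w)`. -/
noncomputable def residueCoeff {n : ℕ} (U : Fin n → ℂ) (j : Fin n) : ℂ :=
  1 / U j * ∏ i, if i = j then 1 else (U i - U j - 1) / (U i - U j)

lemma partialFractions {n : ℕ} {U : Fin n → ℂ} (h0 : ∀ i, U i ≠ 0) (hinj : Function.Injective U)
    {w : ℂ} (hw : w ≠ 0) (hwU : ∀ i, w + U i ≠ 0) :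
    1 / w * ∏ i, (U i + w - 1) / (U i + w) =
      (∏ i, (U i - 1) / U i) * (1 / w) + ∑ j, residueCoeff U j * (1 / (w + U j)) := by
  classical
  let v : Option (Fin n) → ℂ := fun o => o.elim 0 fun i => -U i
  let p : Polynomial ℂ := ∏ i, (Polynomial.X + Polynomial.C (U i - 1))
  have hv : Set.InjOn v ↑(Finset.univ : Finset (Option (Fin n))) := by
    rintro (_ | i) - (_ | j) - h
    · rfl
    · exact absurd (neg_eq_zero.1 h.symm) (h0 j)
    · exact absurd (neg_eq_zero.1 h) (h0 i)
    · exact congrArg some (hinj (neg_injective h))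
  have hdeg : p.degree < ((Finset.univ : Finset (Option (Fin n))).card : ℕ) := by
    have h1 : p.Monic := Polynomial.monic_prod_of_monic _ _ fun i _ => Polynomial.monic_X_add_C _
    have h2 : p.natDegree = n := by
      rw [Polynomial.natDegree_prod_of_monic _ _ fun i _ => Polynomial.monic_X_add_C _]
      simp only [Polynomial.natDegree_X_add_C]
      simp
    rw [Polynomial.degree_eq_natDegree h1.ne_zero, h2]
    simp only [Finset.card_univ, Fintype.card_option, Fintype.card_fin]
    exact_mod_cast Nat.lt_succ_self n
  have hne : ∀ o ∈ (Finset.univ : Finset (Option (Fin n))), w ≠ v o := by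
    rintro (_ | i) - h
    · exact hw h
    · exact hwU i (by rw [h]; simp [v])
  have key := Lagrange.eval_interpolate_not_at_node (fun i => p.eval (v i)) hne
  rw [← Lagrange.eq_interpolate hv hdeg] at key
  have hp : ∀ z, p.eval z = ∏ i, (z + (U i - 1)) := fun z => by
    simp [p, Polynomial.eval_prod]
  have herase : ∀ (o : Option (Fin n)) (f : Option (Fin n) → ℂ),
      ∏ i ∈ Finset.univ.erase o, f i = ∏ i, if i = o then 1 else f i := fun o f => by
    rw [← Finset.filter_ne', Finset.prod_filter]
    exact Finset.prod_congr rfl fun i _ => by by_cases h : i = o <;> simp [h]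
  simp only [Lagrange.eval_nodal, Fintype.prod_option, Fintype.sum_option, Lagrange.nodalWeight,
    herase, hp, v, Option.elim_none, Option.elim_some] at key
  simp only [reduceCtorEq, if_false, if_true, one_mul, sub_zero, sub_neg_eq_add,
    Option.some.injEq, zero_add] at key
  have hP : ∏ i, (w + U i) ≠ 0 := Finset.prod_ne_zero_iff.2 fun i _ => hwU i
  have hlhs : 1 / w * ∏ i, (U i + w - 1) / (U i + w) =
      (∏ i, (w + (U i - 1))) / (w * ∏ i, (w + U i)) := by
    rw [Finset.prod_div_distrib]
    have e1 : ∏ i, (U i + w - 1) = ∏ i, (w + (U i - 1)) := Finset.prod_congr rfl fun i _ => by ring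
    have e2 : ∏ i, (U i + w) = ∏ i, (w + U i) := Finset.prod_congr rfl fun i _ => by ring
    rw [e1, e2]
    field_simp
  rw [hlhs, key, mul_div_cancel_left₀ _ (mul_ne_zero hw hP)]
  congr 1
  · rw [Finset.prod_div_distrib, div_eq_mul_inv, ← Finset.prod_inv_distrib]
    ring
  · refine Finset.sum_congr rfl fun j _ => ?_
    have e : ∏ i, (-U j + (U i - 1)) = -∏ i, if i = j then 1 else (U i - U j - 1) := by
      rw [← Finset.mul_prod_erase _ _ (Finset.mem_univ j),
        ← Finset.mul_prod_erase _ (fun i => if i = j then (1 : ℂ) else _) (Finset.mem_univ j)]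
      rw [if_pos rfl, one_mul, show -U j + (U j - 1) = -1 by ring, neg_one_mul]
      congr 1
      refine Finset.prod_congr rfl fun i hi => ?_
      rw [if_neg (Finset.ne_of_mem_erase hi)]
      ring
    rw [e, residueCoeff]
    have e3 : (∏ i, if i = j then (1 : ℂ) else (U i - U j - 1) / (U i - U j)) =
        (∏ i, if i = j then (1 : ℂ) else (-U j + U i)⁻¹) *
          ∏ i, if i = j then (1 : ℂ) else (U i - U j - 1) := by
      rw [← Finset.prod_mul_distrib]
      refine Finset.prod_congr rfl fun i _ => ?_
      split_ifs
      · simp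
      · rw [div_eq_mul_inv, mul_comm]; congr 2; ring
    rw [e3, inv_neg]
    ring

/-! ### The residues at `z_k = -z_j` -/

/-- The factor of the integrand that depends on the last variable and is holomorphic between the
contours used for that variable. -/
noncomputable def lastFactor {n : ℕ} (θ t X : ℝ) (U : Fin n → ℂ) (w : ℂ) : ℂ :=
  (∏ i, (w - U i) / (w - (U i - 1))) * exp ((t : ℂ) / 2 * (w - θ) ^ 2 + (w - θ) * X)

/-- The residue of the integrand, as a function of its last variable, at `z_k = -z_j`. -/
noncomputable def reflectedResidue {n : ℕ} (θ t : ℝ) (x : EuclideanSpace ℝ (Fin (n + 1)))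
    (j : Fin n) (z : Fin n → ℂ) : ℂ :=
  halfFlatIntegrand n θ t (dropCoord (Fin.last n) x) z *
    (residueCoeff z j * lastFactor θ t (x (Fin.last n)) z (-z j))

/-- The closed form of `reflectedResidue` after the cancellation of common factors: there is no
pole to the right of the contour of `z_j`. -/
noncomputable def reducedResidue {m : ℕ} (θ t : ℝ) (x : EuclideanSpace ℝ (Fin (m + 2)))
    (j : Fin (m + 1)) (z : Fin (m + 1) → ℂ) : ℂ :=
  halfFlatIntegrand m θ t (dropCoord j (dropCoord (Fin.last (m + 1)) x)) (j.removeNth z) *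
    (((∏ i, if j.succAbove i < j then 1
        else (z j - (j.removeNth z i - 1)) / (z j - (j.removeNth z i + 1))) *
      ((z j - 0)⁻¹ * (z j - 1 / 2)⁻¹)) *
      exp ((t : ℝ) * z j ^ 2 + (x j.castSucc - x (Fin.last (m + 1)) : ℝ) * z j +
        (t * θ ^ 2 - θ * (x j.castSucc + x (Fin.last (m + 1))) : ℝ)))

lemma reflectedResidue_eq {m : ℕ} (θ t : ℝ) (x : EuclideanSpace ℝ (Fin (m + 2)))
    (j : Fin (m + 1)) {z : Fin (m + 1) → ℂ} (hz : ∀ i, 1 < (z i).re)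
    (hgap : ∀ a b, a < b → (z b).re + 1 < (z a).re) :
    reflectedResidue θ t x j z = reducedResidue θ t x j z := by
  obtain ⟨w, u, rfl⟩ : ∃ (w : ℂ) (u : Fin m → ℂ), z = j.insertNth (α := fun _ => ℂ) w u :=
    ⟨z j, j.removeNth z, (Fin.insertNth_self_removeNth _ _).symm⟩
  have hw1 : 1 < w.re := by simpa using hz j
  have hu1 : ∀ i, 1 < (u i).re := fun i => by simpa using hz (j.succAbove i)
  have hw0 : w ≠ 0 := fun h => by rw [h] at hw1; simp at hw1; linarith
  have hwh : w - 1 / 2 ≠ 0 := fun h => by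
    have := congrArg re h; simp at this; linarith
  have h1 : ∀ i, u i - w ≠ 0 := fun i h => by
    have := congrArg re h
    simp at this
    rcases lt_or_gt_of_ne (Fin.succAbove_ne j i) with hl | hl <;>
    · have h2 := hgap _ _ hl
      simp at h2
      linarith
  have h2 : ∀ i, u i + w ≠ 0 := fun i h => by
    have := congrArg re h; simp at this; linarith [hu1 i]
  have h3 : ∀ i, u i + w - 1 ≠ 0 := fun i h => by
    have := congrArg re h; simp at this; linarith [hu1 i]
  have h4 : ∀ i, j.succAbove i < j → u i - w - 1 ≠ 0 := fun i hl h => by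
    have := congrArg re h
    have h2 := hgap _ _ hl
    simp at this h2
    linarith
  have h5 : ∀ i, ¬ j.succAbove i < j → w - u i - 1 ≠ 0 := fun i hl h => by
    have := congrArg re h
    have h2 := hgap _ _ (lt_of_le_of_ne (not_lt.1 hl) (Fin.succAbove_ne j i).symm)
    simp at this h2
    linarith
  rw [reflectedResidue, reducedResidue, halfFlatIntegrand_insertNth, residueCoeff, lastFactor,
    Fin.prod_univ_succAbove _ j, Fin.prod_univ_succAbove _ j, oneBodyFactor]
  simp only [Fin.insertNth_apply_same, Fin.insertNth_apply_succAbove, if_true, Fin.succAbove_ne,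
    if_false, one_mul, Fin.removeNth_insertNth]
  have hx : (dropCoord (Fin.last (m + 1)) x) j = x j.castSucc := by simp [dropCoord]
  rw [hx]
  have hprod : (∏ i, if j.succAbove i < j then (1 : ℂ) else (w - (u i - 1)) / (w - (u i + 1))) =
      (∏ i, if j.succAbove i < j then crossFactor (u i) w else crossFactor w (u i)) *
      (∏ i, (u i - w - 1) / (u i - w)) * ∏ i, (-w - u i) / (-w - (u i - 1)) := by
    rw [← Finset.prod_mul_distrib, ← Finset.prod_mul_distrib]
    refine Finset.prod_congr rfl fun i _ => ?_
    have e : (-w - u i) / (-w - (u i - 1)) = (u i + w) / (u i + w - 1) := by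
      rw [← neg_div_neg_eq]; congr 1 <;> ring
    have := h1 i
    have := h2 i
    have := h3 i
    rw [e]
    -- for `i < j` everything cancels; for `i > j` one pole, at `w = u i + 1`, is left
    split_ifs with hl
    · have := h4 i hl
      rw [crossFactor]
      field_simp
    · have := h5 i hl
      have h6 : w - (u i + 1) ≠ 0 := by rwa [← sub_sub]
      have h7 : w + u i ≠ 0 := by rwa [add_comm]
      have h8 : w + u i - 1 ≠ 0 := by rwa [add_comm w]
      have e1 : (u i - w - 1) / (u i - w) = (w - (u i - 1)) / (w - u i) := by
        rw [← neg_div_neg_eq]; congr 1 <;> ring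
      have h9 : w - u i ≠ 0 := by rw [← neg_sub]; exact neg_ne_zero.2 (h1 i)
      rw [crossFactor, e1, add_comm (u i) w, sub_sub w (u i) 1]
      field_simp
  have hexp : Complex.exp ((t : ℝ) * w ^ 2 + (x j.castSucc - x (Fin.last (m + 1)) : ℝ) * w +
      (t * θ ^ 2 - θ * (x j.castSucc + x (Fin.last (m + 1))) : ℝ)) =
      Complex.exp ((t : ℂ) / 2 * (w - θ) ^ 2 + (w - θ) * x j.castSucc) *
      Complex.exp ((t : ℂ) / 2 * (-w - θ) ^ 2 + (-w - θ) * x (Fin.last (m + 1))) := by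
    rw [← Complex.exp_add]
    congr 1
    push_cast
    ring
  have hself : 1 / w * (1 / w * ((-w - w) / (-w - (w - 1)))) = (w - 0)⁻¹ * (w - 1 / 2)⁻¹ := by
    have e : (-w - w) / (-w - (w - 1)) = w / (w - 1 / 2) := by
      have : -w - (w - 1) = -2 * (w - 1 / 2) := by ring
      rw [this, show -w - w = -2 * w by ring, mul_div_mul_left _ _ (by norm_num)]
    rw [e, sub_zero]
    field_simp
  rw [hprod, hexp, ← hself]
  ring

lemma Separated.removeNth {n : ℕ} {δ : ℝ} {α : Fin (n + 1) → ℝ} (h : Separated δ α)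
    (j : Fin (n + 1)) : Separated δ (j.removeNth α) :=
  ⟨h.pos, fun _ _ hab => h.le_sub _ _ (Fin.succAbove_lt_succAbove_iff.2 hab),
    fun _ _ hab => h.le_add _ _ (Fin.succAbove_lt_succAbove_iff.2 hab), fun _ => h.le_self _⟩

lemma Admissible.removeNth {n : ℕ} {α : Fin (n + 1) → ℝ} (h : Admissible α)
    (j : Fin (n + 1)) : Admissible (j.removeNth α) :=
  ⟨fun _ _ hab => h.gap _ _ (Fin.succAbove_lt_succAbove_iff.2 hab), fun _ => h.pos _⟩

lemma measurable_reducedResidue {m : ℕ} (θ t : ℝ) (x : EuclideanSpace ℝ (Fin (m + 2)))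
    (j : Fin (m + 1)) : Measurable (reducedResidue θ t x j) := by
  unfold reducedResidue
  refine Measurable.mul ((measurable_halfFlatIntegrand θ t _).comp ?_) ?_
  · exact measurable_pi_lambda _ fun i => measurable_pi_apply _
  · refine Measurable.mul (Measurable.mul (Finset.measurable_prod _ fun i _ => ?_) ?_) ?_
    · split_ifs
      · exact measurable_const
      · unfold Fin.removeNth; fun_prop
    · fun_prop
    · fun_prop

/-- A constant in the bound of `reducedResidue`; it does not depend on the contour of `z_j`. -/
noncomputable def reducedBound {m : ℕ} (δ θ : ℝ) (x : EuclideanSpace ℝ (Fin (m + 2)))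
    (j : Fin (m + 1)) (α : Fin m → ℝ) : ℝ :=
  rationalBound m δ * Real.exp (∑ i, (α i - θ) ^ 2 + ∑ i, (α i - θ) *
      dropCoord j (dropCoord (Fin.last (m + 1)) x) i) * ((∏ _i : Fin m, (1 + 2 / δ)) * 2) *
    Real.exp (θ ^ 2 - θ * (x j.castSucc + x (Fin.last (m + 1))))

/-- For times `t ≤ 1` and the contour `Re z_j = R`, a Gaussian bound whose dependence on `R` is
explicit. -/
lemma norm_reducedResidue_le {m : ℕ} {δ θ t : ℝ} (ht : 0 < t) (ht1 : t ≤ 1)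
    (x : EuclideanSpace ℝ (Fin (m + 2))) (j : Fin (m + 1)) {α : Fin m → ℝ} (hα : Separated δ α)
    {R : ℝ} (hR : 1 < R) (hRα : ∀ i, ¬ j.succAbove i < j → δ ≤ R - α i - 1)
    (y : Fin (m + 1) → ℝ) :
    ‖reducedResidue θ t x j (verticalPoint (j.insertNth (α := fun _ => ℝ) R α) y)‖ ≤
      reducedBound δ θ x j α *
        Real.exp (t * R ^ 2 + (x j.castSucc - x (Fin.last (m + 1))) * R) *
        Real.exp (-(t / 2) * ∑ a, y a ^ 2) := by
  obtain ⟨s, u, rfl⟩ : ∃ (s : ℝ) (u : Fin m → ℝ), y = j.insertNth (α := fun _ => ℝ) s u :=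
    ⟨y j, j.removeNth y, (Fin.insertNth_self_removeNth _ _).symm⟩
  have hδ := hα.pos
  rw [verticalPoint_insertNth, reducedResidue]
  simp only [Fin.insertNth_apply_same, Fin.removeNth_insertNth]
  set w : ℂ := (R : ℂ) + s * I with hw
  have hwre : w.re = R := by simp [hw]
  have hwim : w.im = s := by simp [hw]
  have hb : 0 ≤ rationalBound m δ := (norm_nonneg _).trans (hα.norm_rationalPart_le 0)
  have b1 := hα.norm_halfFlatIntegrand_le θ t (dropCoord j (dropCoord (Fin.last (m + 1)) x)) u
  have b1' : rationalBound m δ * Real.exp (t / 2 * ∑ i, (α i - θ) ^ 2 + ∑ i, (α i - θ) *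
      dropCoord j (dropCoord (Fin.last (m + 1)) x) i) * Real.exp (-(t / 2) * ∑ a, u a ^ 2) ≤
      rationalBound m δ * Real.exp (∑ i, (α i - θ) ^ 2 + ∑ i, (α i - θ) *
      dropCoord j (dropCoord (Fin.last (m + 1)) x) i) * Real.exp (-(t / 2) * ∑ a, u a ^ 2) := by
    have hS : 0 ≤ ∑ i, (α i - θ) ^ 2 := Finset.sum_nonneg fun _ _ => sq_nonneg _
    refine mul_le_mul_of_nonneg_right (mul_le_mul_of_nonneg_left (Real.exp_le_exp.2 ?_) hb)
      (Real.exp_nonneg _)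
    nlinarith
  have b2 : ‖∏ i, if j.succAbove i < j then (1 : ℂ)
      else (w - (verticalPoint α u i - 1)) / (w - (verticalPoint α u i + 1))‖ ≤
      ∏ _i : Fin m, (1 + 2 / δ) := by
    rw [norm_prod]
    refine Finset.prod_le_prod (fun _ _ => norm_nonneg _) fun i _ => ?_
    split_ifs with hl
    · rw [norm_one]; linarith [show 0 ≤ 2 / δ by positivity]
    · have := norm_div_add_one_le hδ (p := w - (verticalPoint α u i - 1))
        (q := w - (verticalPoint α u i + 1)) (c := 2) (by
          apply le_of_eq; congr 1; ring) (by
          have h1 := hRα i hl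
          have : (w - (verticalPoint α u i + 1)).re = R - α i - 1 := by
            simp [hwre, verticalPoint]; ring
          rw [this]
          exact h1.trans (le_abs_self _))
      simpa using this
  have b3 : ‖(w - 0)⁻¹ * (w - 1 / 2)⁻¹‖ ≤ 2 := by
    have e1 : 1 ≤ ‖w - 0‖ := by
      refine le_trans ?_ ((le_abs_self _).trans (Complex.abs_re_le_norm _))
      simp [hwre]; linarith
    have e2 : 1 / 2 ≤ ‖w - 1 / 2‖ := by
      refine le_trans ?_ ((le_abs_self _).trans (Complex.abs_re_le_norm _))
      simp [hwre]; linarith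
    rw [norm_mul, norm_inv, norm_inv]
    calc ‖w - 0‖⁻¹ * ‖w - 1 / 2‖⁻¹ ≤ (1 : ℝ)⁻¹ * (1 / 2 : ℝ)⁻¹ := by gcongr
      _ = 2 := by norm_num
  have b4 : ‖exp ((t : ℝ) * w ^ 2 + (x j.castSucc - x (Fin.last (m + 1)) : ℝ) * w +
        (t * θ ^ 2 - θ * (x j.castSucc + x (Fin.last (m + 1))) : ℝ))‖ ≤
      Real.exp (θ ^ 2 - θ * (x j.castSucc + x (Fin.last (m + 1)))) *
        (Real.exp (t * R ^ 2 + (x j.castSucc - x (Fin.last (m + 1))) * R) *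
          Real.exp (-(t / 2) * s ^ 2)) := by
    rw [Complex.norm_exp, ← Real.exp_add, ← Real.exp_add, Real.exp_le_exp, add_re, add_re,
      ofReal_re, re_ofReal_mul, re_ofReal_mul, pow_two, mul_re, hwre, hwim]
    nlinarith [sq_nonneg θ, sq_nonneg s]
  rw [Fin.sum_univ_succAbove _ j]
  simp only [Fin.insertNth_apply_same, Fin.insertNth_apply_succAbove]
  rw [norm_mul, norm_mul, norm_mul]
  calc _ ≤ (rationalBound m δ * Real.exp (∑ i, (α i - θ) ^ 2 + ∑ i, (α i - θ) *
        dropCoord j (dropCoord (Fin.last (m + 1)) x) i) * Real.exp (-(t / 2) * ∑ a, u a ^ 2)) *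
        (((∏ _i : Fin m, (1 + 2 / δ)) * 2) *
        (Real.exp (θ ^ 2 - θ * (x j.castSucc + x (Fin.last (m + 1)))) *
        (Real.exp (t * R ^ 2 + (x j.castSucc - x (Fin.last (m + 1))) * R) *
          Real.exp (-(t / 2) * s ^ 2)))) := by
        refine mul_le_mul (b1.trans b1') (mul_le_mul (mul_le_mul b2 b3 (norm_nonneg _) ?_) b4
          (norm_nonneg _) ?_) (by positivity) ?_
        · positivity
        · positivity
        · positivity
    _ = _ := by
        rw [mul_add (-(t / 2)), Real.exp_add (-(t / 2) * s ^ 2), reducedBound]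
        ring

lemma integrable_reducedResidue {m : ℕ} {δ θ t : ℝ} (ht : 0 < t) (ht1 : t ≤ 1)
    (x : EuclideanSpace ℝ (Fin (m + 2))) (j : Fin (m + 1)) {α : Fin m → ℝ} (hα : Separated δ α)
    {R : ℝ} (hR : 1 < R) (hRα : ∀ i, ¬ j.succAbove i < j → δ ≤ R - α i - 1) :
    Integrable fun y => reducedResidue θ t x j
      (verticalPoint (j.insertNth (α := fun _ => ℝ) R α) y) :=
  ((integrable_gaussian_pi _ (half_pos ht)).const_mul _).mono'
    ((measurable_reducedResidue θ t x j).comp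
      (continuous_verticalPoint _).measurable).aestronglyMeasurable
    (ae_of_all _ (norm_reducedResidue_le ht ht1 x j hα hR hRα))

lemma reflectedResidue_verticalPoint {m : ℕ} {α : Fin (m + 1) → ℝ} (hα : Admissible α)
    (h1 : ∀ i, 1 < α i) (θ t : ℝ) (x : EuclideanSpace ℝ (Fin (m + 2))) (j : Fin (m + 1))
    (y : Fin (m + 1) → ℝ) :
    reflectedResidue θ t x j (verticalPoint α y) = reducedResidue θ t x j (verticalPoint α y) :=
  reflectedResidue_eq θ t x j (fun i => by simpa [verticalPoint] using h1 i)
    fun a b hab => by simpa [verticalPoint] using hα.gap a b hab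

lemma Admissible.le_of_not_lt {m : ℕ} {δ : ℝ} {α : Fin (m + 1) → ℝ} (hα : Admissible α)
    (hδ : Separated δ α) (j : Fin (m + 1)) (i : Fin m) (hl : ¬ j.succAbove i < j) :
    δ ≤ α j - j.removeNth α i - 1 := by
  have hlt := lt_of_le_of_ne (not_lt.1 hl) (Fin.succAbove_ne j i).symm
  have h := hδ.le_sub _ _ hlt
  rwa [abs_of_pos (by linarith [hα.gap _ _ hlt])] at h

lemma integrable_reflectedResidue {n : ℕ} {α : Fin n → ℝ} (hα : Admissible α)
    (h1 : ∀ i, 1 < α i) (θ : ℝ) {t : ℝ} (ht : 0 < t) (ht1 : t ≤ 1)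
    (x : EuclideanSpace ℝ (Fin (n + 1))) (j : Fin n) :
    Integrable fun y => reflectedResidue θ t x j (verticalPoint α y) := by
  obtain ⟨m, rfl⟩ : ∃ m, n = m + 1 := ⟨n - 1, by have := j.2; omega⟩
  simp only [reflectedResidue_verticalPoint hα h1]
  obtain ⟨δ, hδ⟩ := hα.exists_separated
  have := integrable_reducedResidue (θ := θ) ht ht1 x j (hδ.removeNth j) (h1 j)
    (hα.le_of_not_lt hδ j)
  rwa [Fin.insertNth_self_removeNth] at this

/-- The residue at `z_k = -z_j` contributes nothing in the limit: its exponential factor is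
`exp (t z_j ^ 2 - (x_k - x_j) z_j)` with `x_k - x_j > 0`, and the contour of `z_j` can be moved to
the right. -/
theorem tendsto_integral_reflectedResidue {n : ℕ} {α : Fin n → ℝ} (hα : Admissible α)
    (h1 : ∀ i, 1 < α i) (θ : ℝ) (x : EuclideanSpace ℝ (Fin (n + 1))) (j : Fin n)
    (hx : x j.castSucc < x (Fin.last n)) :
    Tendsto (fun t => ∫ y, reflectedResidue θ t x j (verticalPoint α y)) (𝓝[>] 0) (𝓝 0) := by
  obtain ⟨m, rfl⟩ : ∃ m, n = m + 1 := ⟨n - 1, by have := j.2; omega⟩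
  simp only [reflectedResidue_verticalPoint hα h1]
  obtain ⟨δ, hδ⟩ := hα.exists_separated
  set α₀ := j.removeNth α with hα₀
  have hαe : j.insertNth (α := fun _ => ℝ) (α j) α₀ = α := Fin.insertNth_self_removeNth _ _
  have hδ₀ : Separated δ α₀ := hδ.removeNth j
  have hj : ∀ R, α j ≤ R → ∀ i, ¬ j.succAbove i < j → δ ≤ R - α₀ i - 1 := fun R hR i hi => by
    linarith [hα.le_of_not_lt hδ j i hi]
  have shift : ∀ t, 0 < t → t ≤ 1 → ∀ R, α j ≤ R →
      ∫ y, reducedResidue θ t x j (verticalPoint α y) =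
      ∫ y, reducedResidue θ t x j (verticalPoint (j.insertNth (α := fun _ => ℝ) R α₀) y) := by
    intro t ht ht1 R hR
    have := integral_insertNth_congr j (β := α j) (β' := R) α₀ (F := reducedResidue θ t x j)
      (integrable_reducedResidue ht ht1 x j hδ₀ (h1 j) (hj _ le_rfl))
      (integrable_reducedResidue ht ht1 x j hδ₀ ((h1 j).trans_le hR) (hj _ hR)) (by
        intro u
        have hf : StripGaussian (α j) R (fun w => reducedResidue θ t x j
            (j.insertNth (α := fun _ => ℂ) w (verticalPoint α₀ u))) := by
          simp only [reducedResidue, Fin.insertNth_apply_same, Fin.removeNth_insertNth]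
          refine (StripRegular.const _ _ _).mul_gaussian (StripRegular.mul_gaussian
            (.mul (.prod _ fun i _ => ?_) (.mul (.inv_sub (Or.inl ?_)) (.inv_sub (Or.inl ?_))))
            ⟨by fun_prop, .exp_quadratic _ _ ht _ _⟩)
          · split_ifs with hl
            · exact .const _ _ _
            · refine .ratio _ (Or.inl ?_)
              have := hj _ le_rfl i hl
              have := hδ.pos
              simp [verticalPoint]
              linarith
          · simpa using hα.pos j
          · have := h1 j
            simp
            linarith
        exact integral_verticalLine_eq hR hf.diff hf.decay)
    rwa [hαe] at this
  set d := x (Fin.last (m + 1)) - x j.castSucc with hd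
  have hd0 : 0 < d := sub_pos.2 hx
  refine tendsto_zero_of_norm_le (m + 1) (c := d ^ 2 / 4) (K := reducedBound δ θ x j α₀)
    (by positivity) ?_
  have hlarge : ∀ᶠ t : ℝ in 𝓝[>] 0, α j ≤ d / 2 * t⁻¹ :=
    (tendsto_inv_nhdsGT_zero.const_mul_atTop (half_pos hd0)).eventually_ge_atTop _
  have hone : ∀ᶠ t : ℝ in 𝓝[>] 0, t ≤ 1 :=
    nhdsWithin_le_nhds (eventually_le_nhds one_pos)
  filter_upwards [self_mem_nhdsWithin, hlarge, hone] with t ht hR ht1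
  have ht : 0 < t := ht
  -- the minimum of `t * R ^ 2 - d * R` is attained at `R = d / (2 * t)`
  rw [shift t ht ht1 _ hR, ← mul_assoc]
  refine (norm_integral_le_of_gaussian (half_pos ht)
    (norm_reducedResidue_le ht ht1 x j hδ₀ ((h1 j).trans_le hR) (hj _ hR))).trans_eq ?_
  congr 3
  rw [show x j.castSucc - x (Fin.last (m + 1)) = -d by rw [hd]; ring]
  field_simp
  ring

/-! ### Moving the contour of the last variable -/

/-- As a function of its last variable, the integrand is `lastFactor` times a sum of simple
fractions with poles at `0` and at the points `-z_j`. -/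
lemma halfFlatIntegrand_last_eq {n : ℕ} (θ t : ℝ) (x : EuclideanSpace ℝ (Fin (n + 1)))
    {U : Fin n → ℂ} (h0 : ∀ i, U i ≠ 0) (hinj : Function.Injective U) {w : ℂ} (hw : w ≠ 0)
    (hwU : ∀ i, w + U i ≠ 0) :
    halfFlatIntegrand (n + 1) θ t x ((Fin.last n).insertNth (α := fun _ => ℂ) w U) =
      halfFlatIntegrand n θ t (dropCoord (Fin.last n) x) U *
        ((∏ i, (U i - 1) / U i) * (lastFactor θ t (x (Fin.last n)) U w / (w - 0)) +
          ∑ j, residueCoeff U j * (lastFactor θ t (x (Fin.last n)) U w / (w - -U j))) := by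
  rw [halfFlatIntegrand_insertNth]
  have hl : ∀ i : Fin n, (Fin.last n).succAbove i < Fin.last n := fun i => by
    rw [Fin.succAbove_last]; exact Fin.castSucc_lt_last i
  simp only [hl, if_true]
  have hcross : ∏ i, crossFactor (U i) w =
      (∏ i, (w - U i) / (w - (U i - 1))) * ∏ i, (U i + w - 1) / (U i + w) := by
    rw [← Finset.prod_mul_distrib]
    refine Finset.prod_congr rfl fun i _ => ?_
    rw [crossFactor, ← neg_div_neg_eq]
    congr 2 <;> ring
  have hpf := partialFractions h0 hinj hw hwU
  have hsum : (∏ i, (U i - 1) / U i) * (lastFactor θ t (x (Fin.last n)) U w / (w - 0)) +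
      ∑ j, residueCoeff U j * (lastFactor θ t (x (Fin.last n)) U w / (w - -U j)) =
      lastFactor θ t (x (Fin.last n)) U w * (1 / w * ∏ i, (U i + w - 1) / (U i + w)) := by
    rw [hpf, mul_add, Finset.mul_sum]
    congr 1
    · rw [sub_zero]; ring
    · refine Finset.sum_congr rfl fun j _ => ?_
      rw [sub_neg_eq_add]; ring
  rw [hsum, hcross, lastFactor, oneBodyFactor]
  ring

/-- The residue theorem for the last variable: moving its contour to `Re w = -R` crosses the poles
at `0` and at the points `-z_j`. -/
lemma integral_last_eq {n : ℕ} {α : Fin n → ℝ} (hα : Admissible α) {β R : ℝ} (hβ : 0 < β)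
    (hβα : ∀ i, β + 1 < α i) (hR : 0 < R) (hRα : ∀ i, α i < R) (θ : ℝ) {t : ℝ} (ht : 0 < t)
    (x : EuclideanSpace ℝ (Fin (n + 1))) (u : Fin n → ℝ) :
    ∫ s : ℝ, halfFlatIntegrand (n + 1) θ t x
        ((Fin.last n).insertNth (α := fun _ => ℂ) ((β : ℂ) + s * I) (verticalPoint α u)) =
      (∫ s : ℝ, halfFlatIntegrand (n + 1) θ t x ((Fin.last n).insertNth (α := fun _ => ℂ)
        (((-R : ℝ) : ℂ) + s * I) (verticalPoint α u))) +
      2 * Real.pi * (exp (t / 2 * θ ^ 2 - θ * x (Fin.last n)) *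
          halfFlatIntegrand n θ t (dropCoord (Fin.last n) x) (verticalPoint α u) +
        ∑ j, reflectedResidue θ t x j (verticalPoint α u)) := by
  set U := verticalPoint α u with hU
  set X := x (Fin.last n) with hX
  have hUre : ∀ i, (U i).re = α i := fun i => by simp [hU, verticalPoint]
  have h0 : ∀ i, U i ≠ 0 := fun i h => by
    have := hUre i
    rw [h] at this
    simp at this
    linarith [hα.pos i]
  have hinj : Function.Injective U := fun a b hab => by
    by_contra hne
    have := congrArg re hab
    rw [hUre, hUre] at this
    rcases lt_or_gt_of_ne hne with h | h <;> linarith [hα.gap _ _ h]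
  have hg : StripGaussian (-R) β (lastFactor θ t X U) := by
    unfold lastFactor
    refine StripRegular.mul_gaussian (.prod _ fun i _ => .ratio _ (Or.inr ?_)) (.exp _ _ _ _ ht)
    simp [hUre]
    linarith [hβα i]
  -- every line `Re w = σ` used below avoids the poles, so that the partial fractions integrate
  have line : ∀ σ ∈ Set.Icc (-R) β, σ ≠ 0 → (∀ i, σ ≠ -α i) →
      ∫ s : ℝ, halfFlatIntegrand (n + 1) θ t x
        ((Fin.last n).insertNth (α := fun _ => ℂ) ((σ : ℂ) + s * I) U) =
      halfFlatIntegrand n θ t (dropCoord (Fin.last n) x) U *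
        ((∏ i, (U i - 1) / U i) *
          (∫ s : ℝ, lastFactor θ t X U (σ + s * I) / (σ + s * I - 0)) +
          ∑ j, residueCoeff U j *
            ∫ s : ℝ, lastFactor θ t X U (σ + s * I) / (σ + s * I - -U j)) := by
    intro σ hσ hσ0 hσα
    have hint : ∀ q : ℂ, q.re ≠ σ →
        Integrable fun s : ℝ => lastFactor θ t X U (σ + s * I) / (σ + s * I - q) := by
      intro q hq
      have hsub : verticalStrip σ σ ⊆ verticalStrip (-R) β := fun z hz =>
        ⟨hσ.1.trans hz.1, hz.2.trans hσ.2⟩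
      have hg' : StripGaussian σ σ (lastFactor θ t X U) := by
        obtain ⟨C, M, c, hC, hc, H⟩ := hg.decay
        exact ⟨hg.diff.mono hsub, C, M, c, hC, hc, fun z hz => H z (hsub hz)⟩
      have h := (StripRegular.inv_sub (a := σ) (b := σ) (d := q)
        (lt_or_gt_of_ne hq)).mul_gaussian hg'
      refine (h.decay.integrable h.diff.continuousOn ⟨le_rfl, le_rfl⟩).congr
        (ae_of_all _ fun s => ?_)
      simp only
      rw [div_eq_mul_inv, mul_comm]
    have hi0 := hint 0 (by simpa using hσ0.symm)
    have hij : ∀ j, Integrable fun s : ℝ =>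
        lastFactor θ t X U (σ + s * I) / (σ + s * I - -U j) := fun j =>
      hint _ (by rw [neg_re, hUre]; exact (hσα j).symm)
    have e : ∀ s : ℝ, halfFlatIntegrand (n + 1) θ t x
        ((Fin.last n).insertNth (α := fun _ => ℂ) ((σ : ℂ) + s * I) U) = _ := fun s =>
      halfFlatIntegrand_last_eq θ t x h0 hinj (w := (σ : ℂ) + s * I)
        (fun h => hσ0 (by simpa using congrArg re h))
        (fun i h => hσα i (by
          have := congrArg re h
          simp [hUre] at this
          linarith))
    simp only [e]
    rw [integral_const_mul, integral_add (hi0.const_mul _)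
      (integrable_finsetSum _ fun j _ => (hij j).const_mul _), integral_const_mul,
      integral_finsetSum _ fun j _ => (hij j).const_mul _]
    simp only [integral_const_mul]
  have hR' : -R < β := by linarith
  rw [line β ⟨hR'.le, le_rfl⟩ hβ.ne' fun i => by linarith [hα.pos i],
    line (-R) ⟨le_rfl, hR'.le⟩ (by linarith) fun i => by linarith [hRα i]]
  have r0 := integral_verticalLine_sub_eq_residue (p := 0) hg.diff hg.decay (by simpa) (by simpa)
  have rj : ∀ j, _ := fun j => integral_verticalLine_sub_eq_residue (p := -U j) hg.diff hg.decay
    (by rw [neg_re, hUre]; linarith [hRα j]) (by rw [neg_re, hUre]; linarith [hα.pos j])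
  have hres0 : (∏ i, (U i - 1) / U i) * lastFactor θ t X U 0 =
      exp (t / 2 * θ ^ 2 - θ * X) := by
    have h1 : ∀ i, U i - 1 ≠ 0 := fun i h => by
      have := congrArg re h
      simp [hUre] at this
      linarith [hβα i]
    rw [lastFactor, ← mul_assoc, ← Finset.prod_mul_distrib]
    rw [Finset.prod_eq_one fun i _ => ?_, one_mul]
    · congr 1; ring
    · have := h0 i
      have := h1 i
      rw [zero_sub, zero_sub, neg_div_neg_eq]
      field_simp
  simp only [reflectedResidue]
  rw [← Finset.mul_sum, ← hres0, sub_eq_iff_eq_add.1 r0]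
  simp only [fun j => sub_eq_iff_eq_add.1 (rj j), mul_add, Finset.sum_add_distrib]
  have e : ∑ j, residueCoeff U j * (2 * Real.pi * lastFactor θ t X U (-U j)) =
      2 * Real.pi * ∑ j, residueCoeff U j * lastFactor θ t X U (-U j) := by
    rw [Finset.mul_sum]
    exact Finset.sum_congr rfl fun j _ => by ring
  rw [e]
  ring

/-! ### The initial condition when all coordinates are positive -/

lemma integral_add_const_mul_add_sum {Ω ι : Type*} [Fintype ι] [MeasurableSpace Ω]
    {μ : Measure Ω} {f g : Ω → ℂ} {h : ι → Ω → ℂ} (hf : Integrable f μ) (hg : Integrable g μ)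
    (hh : ∀ j, Integrable (h j) μ) (b c : ℂ) :
    ∫ u, f u + b * (c * g u + ∑ j, h j u) ∂μ =
      (∫ u, f u ∂μ) + b * (c * (∫ u, g u ∂μ) + ∑ j, ∫ u, h j u ∂μ) := by
  have hs := integrable_finsetSum Finset.univ fun j _ => hh j
  have e : ∫ u, c * g u + ∑ j, h j u ∂μ = c * (∫ u, g u ∂μ) + ∑ j, ∫ u, h j u ∂μ := by
    refine (integral_add (hg.const_mul c) hs).trans ?_
    rw [integral_const_mul, integral_finsetSum _ fun j _ => hh j]
  refine (integral_add hf (((hg.const_mul c).add hs).const_mul b)).trans ?_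
  exact congrArg _ ((integral_const_mul _ _).trans (congrArg _ e))

/-- If all coordinates are positive, the contour of the last variable is moved to the left. Only
the residue at `0` survives in the limit; it is the same integral with one variable less. -/
theorem tendsto_halfFlatFormula_of_pos (θ : ℝ) : ∀ (n : ℕ) {α : Fin n → ℝ} (_ : Admissible α)
    (x : EuclideanSpace ℝ (Fin n)) (_ : x ∈ weylChamber n) (_ : ∀ a, 0 < x a),
    Tendsto (fun t => halfFlatFormula n θ α t x) (𝓝[>] 0)
      (𝓝 ((∏ a, Real.exp (-θ * x a) : ℝ) : ℂ)) := by
  intro n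
  induction n with
  | zero =>
    intro α _ x _ _
    refine tendsto_const_nhds.congr fun t => ?_
    rw [halfFlatFormula_eq]
    simp [halfFlatIntegrand, Measure.real, volume_pi, Measure.pi_empty_univ]
  | succ n ih =>
    intro α hα x hx hpos
    set α₀ := (Fin.last n).removeNth α with hα₀
    set X := x (Fin.last n) with hX
    have hX0 : 0 < X := hpos _
    have hαe : (Fin.last n).insertNth (α := fun _ => ℝ) (α (Fin.last n)) α₀ = α :=
      Fin.insertNth_self_removeNth _ _
    have hadm : Admissible α₀ := hα.removeNth _
    obtain ⟨δ, hδ⟩ := hα.exists_separated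
    have hs : ∀ i, α₀ i = α i.castSucc := fun i => by
      rw [hα₀, Fin.removeNth, Fin.succAbove_last]
    have hβα : ∀ i, α (Fin.last n) + 1 < α₀ i := fun i => by
      rw [hs]; exact hα.gap _ _ (Fin.castSucc_lt_last i)
    have hβ := hα.pos (Fin.last n)
    have h1 : ∀ i, 1 < α₀ i := fun i => by linarith [hβα i]
    set R₀ := 1 + δ + ∑ i, α₀ i with hR₀
    have hδ0 := hδ.pos
    have hle : ∀ i, α₀ i ≤ ∑ i, α₀ i := fun i =>
      Finset.single_le_sum (f := α₀) (fun i _ => (hadm.pos i).le) (Finset.mem_univ i)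
    have hsum0 : 0 ≤ ∑ i, α₀ i := Finset.sum_nonneg fun i _ => (hadm.pos i).le
    have hsep : ∀ R, R₀ ≤ R →
        Separated δ ((Fin.last n).insertNth (α := fun _ => ℝ) (-R) α₀) := by
      intro R hR
      have hc : ∀ i : Fin n, (Fin.last n).insertNth (α := fun _ => ℝ) (-R) α₀ i.castSucc =
          α i.castSucc := fun i => by
        rw [← Fin.succAbove_last, Fin.insertNth_apply_succAbove, hs, Fin.succAbove_last]
      refine ⟨hδ0, fun a b hab => ?_, fun a b hab => ?_, fun a => ?_⟩
      · obtain ⟨a, rfl⟩ := Fin.exists_castSucc_eq.2 (Fin.ne_last_of_lt hab)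
        rw [hc]
        refine Fin.lastCases ?_ (fun b hab => ?_) b hab
        · intro _
          rw [Fin.insertNth_apply_same]
          refine le_trans ?_ (le_abs_self _)
          linarith [hα.pos a.castSucc]
        · rw [hc]; exact hδ.le_sub _ _ hab
      · obtain ⟨a, rfl⟩ := Fin.exists_castSucc_eq.2 (Fin.ne_last_of_lt hab)
        rw [hc]
        refine Fin.lastCases ?_ (fun b hab => ?_) b hab
        · intro _
          rw [Fin.insertNth_apply_same]
          refine le_trans ?_ (neg_le_abs _)
          have := hle a
          rw [hs] at this
          linarith
        · rw [hc]; exact hδ.le_add _ _ hab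
      · refine Fin.lastCases ?_ (fun a => ?_) a
        · rw [Fin.insertNth_apply_same, abs_neg]
          exact le_trans (by linarith) (le_abs_self _)
        · rw [hc]; exact hδ.le_self _
    set x' := dropCoord (Fin.last n) x with hx'
    have hx'a : ∀ a, x' a = x a.castSucc := fun a => by simp [hx', dropCoord]
    -- the decomposition of the integral into residues and a remainder
    have decomp : ∀ t, 0 < t → t ≤ 1 → ∀ R, R₀ ≤ R → halfFlatFormula (n + 1) θ α t x =
        1 / (2 * (Real.pi : ℂ)) ^ (n + 1) * (∫ y, halfFlatIntegrand (n + 1) θ t x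
          (verticalPoint ((Fin.last n).insertNth (α := fun _ => ℝ) (-R) α₀) y)) +
        exp (t / 2 * θ ^ 2 - θ * X) * halfFlatFormula n θ α₀ t x' +
        1 / (2 * (Real.pi : ℂ)) ^ n *
          ∑ j, ∫ y, reflectedResidue θ t x j (verticalPoint α₀ y) := by
      intro t ht ht1 R hR
      have hI := hδ.integrable_halfFlatIntegrand θ ht x
      have hI' := (hsep R hR).integrable_halfFlatIntegrand θ ht x
      obtain ⟨δ', hδ'⟩ := hadm.exists_separated
      have hI₀ := hδ'.integrable_halfFlatIntegrand θ ht x'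
      have hIj : ∀ j, Integrable fun y => reflectedResidue θ t x j (verticalPoint α₀ y) := fun j =>
        integrable_reflectedResidue hadm h1 θ ht ht1 x j
      rw [halfFlatFormula_eq, halfFlatFormula_eq,
        integral_eq_integral_insertNth (Fin.last n) hI,
        integral_eq_integral_insertNth (Fin.last n) hI']
      have hin : ∀ (u : Fin n → ℝ) (s : ℝ),
          verticalPoint α ((Fin.last n).insertNth (α := fun _ => ℝ) s u) =
          (Fin.last n).insertNth (α := fun _ => ℂ) ((α (Fin.last n) : ℂ) + s * I)
            (verticalPoint α₀ u) := fun u s => by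
        rw [← verticalPoint_insertNth, hαe]
      have hrem : Integrable fun u : Fin n → ℝ => ∫ s : ℝ, halfFlatIntegrand (n + 1) θ t x
          ((Fin.last n).insertNth (α := fun _ => ℂ) (((-R : ℝ) : ℂ) + s * I)
            (verticalPoint α₀ u)) := by
        have := (integrable_insertNth (Fin.last n) hI').integral_prod_right
        simpa only [verticalPoint_insertNth] using this
      have hin' := fun u => integral_last_eq hadm hβ hβα (R := R) (by linarith)
        (fun i => by linarith [hle i]) θ ht x u
      simp only [hin, hin', verticalPoint_insertNth]
      rw [integral_add_const_mul_add_sum hrem hI₀ hIj]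
      have hpi : (2 * (Real.pi : ℂ)) ≠ 0 := by
        simp [Real.pi_ne_zero]
      have alg : ∀ A B E S P : ℂ, P ≠ 0 → 1 / P ^ (n + 1) * (A + P * (E * B + S)) =
          1 / P ^ (n + 1) * A + E * (1 / P ^ n * B) + 1 / P ^ n * S := fun A B E S P hP => by
        field_simp
        ring
      exact alg _ _ _ _ _ hpi
    have hlarge : ∀ᶠ t : ℝ in 𝓝[>] 0, R₀ ≤ -θ + X * t⁻¹ :=
      (tendsto_atTop_add_const_left _ _
        (tendsto_inv_nhdsGT_zero.const_mul_atTop hX0)).eventually_ge_atTop _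
    have hone : ∀ᶠ t : ℝ in 𝓝[>] 0, t ≤ 1 :=
      nhdsWithin_le_nhds (eventually_le_nhds one_pos)
    have hrem : Tendsto (fun t : ℝ => 1 / (2 * (Real.pi : ℂ)) ^ (n + 1) *
        (∫ y, halfFlatIntegrand (n + 1) θ t x (verticalPoint
          ((Fin.last n).insertNth (α := fun _ => ℝ) (-(-θ + X * t⁻¹)) α₀) y)))
        (𝓝[>] 0) (𝓝 0) := by
      refine tendsto_zero_of_norm_le (n + 1) (c := X ^ 2 / 2)
        (K := ‖1 / (2 * (Real.pi : ℂ)) ^ (n + 1)‖ * (rationalBound (n + 1) δ *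
          Real.exp (∑ i, (α₀ i - θ) ^ 2 + ∑ i, (α₀ i - θ) * x ((Fin.last n).succAbove i))))
        (by positivity) ?_
      filter_upwards [self_mem_nhdsWithin, hlarge, hone] with t ht hR ht1
      have ht : 0 < t := ht
      -- the exponent `t / 2 * (σ - θ) ^ 2 + (σ - θ) * X` is minimal on the line `σ = θ - X / t`
      rw [norm_mul, mul_assoc]
      refine mul_le_mul_of_nonneg_left ((norm_integral_insertNth_le (Fin.last n) α₀ _ (hsep _ hR)
        θ ht ht1 x).trans_eq ?_) (norm_nonneg _)
      congr 3
      rw [← hX]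
      field_simp
      ring
    have hmain : Tendsto (fun t : ℝ => exp (t / 2 * θ ^ 2 - θ * X) * halfFlatFormula n θ α₀ t x')
        (𝓝[>] 0) (𝓝 (exp (-θ * X) * ((∏ a, Real.exp (-θ * x' a) : ℝ) : ℂ))) := by
      refine Tendsto.mul ?_ (ih hadm x' (fun a b hab => ?_) fun a => ?_)
      · have hcont : Continuous fun t : ℝ => exp ((t : ℂ) / 2 * θ ^ 2 - θ * X) := by fun_prop
        have := (hcont.tendsto 0).mono_left (nhdsWithin_le_nhds (s := Set.Ioi (0 : ℝ)))
        simpa using this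
      · rw [hx'a, hx'a]
        exact hx _ _ (Fin.castSucc_lt_castSucc_iff.2 hab)
      · rw [hx'a]
        exact hpos _
    have hres : Tendsto (fun t : ℝ => 1 / (2 * (Real.pi : ℂ)) ^ n *
        ∑ j, ∫ y, reflectedResidue θ t x j (verticalPoint α₀ y)) (𝓝[>] 0) (𝓝 0) := by
      have := tendsto_finsetSum Finset.univ fun j _ =>
        tendsto_integral_reflectedResidue hadm h1 θ x j (hx _ _ (Fin.castSucc_lt_last j))
      simpa using this.const_mul (1 / (2 * (Real.pi : ℂ)) ^ n)
    have hlim := (hrem.add hmain).add hres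
    rw [zero_add, add_zero] at hlim
    have hval : exp (-θ * X) * ((∏ a, Real.exp (-θ * x' a) : ℝ) : ℂ) =
        ((∏ a, Real.exp (-θ * x a) : ℝ) : ℂ) := by
      rw [Fin.prod_univ_castSucc]
      simp only [hx'a, ← hX]
      push_cast
      ring
    rw [hval] at hlim
    refine hlim.congr' ?_
    filter_upwards [self_mem_nhdsWithin, hlarge, hone] with t ht hR ht1
    exact (decomp t ht ht1 _ hR).symm

theorem mainTheorem6 (k : ℕ) (hk : 0 < k) (θ : ℝ) (hθ : 0 ≤ θ) (α : Fin k → ℝ)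
    (hα : ∀ a b : Fin k, (b : ℕ) = (a : ℕ) + 1 → α b + 1 < α a)
    (hα_pos : ∀ a : Fin k, 0 < α a) :
    (∀ t : ℝ, 0 < t → ∀ x : EuclideanSpace ℝ (Fin k), x ∈ closure (weylChamber k) →
      Integrable (fun y : Fin k → ℝ => halfFlatIntegrand k θ t x (verticalPoint α y))) ∧
    IsDeltaBoseSolution k (halfFlatFormula k θ α) ∧
    (∀ x : EuclideanSpace ℝ (Fin k), x ∈ weylChamber k → x ⟨0, hk⟩ ≠ 0 →
      Tendsto (fun t : ℝ => halfFlatFormula k θ α t x) (𝓝[>] 0)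
        (𝓝 ((tiltedHalfFlat k θ x : ℝ) : ℂ))) := by
  obtain ⟨n, rfl⟩ : ∃ n, k = n + 1 := ⟨k - 1, by omega⟩
  have hadm : Admissible α := by
    refine ⟨fun a b hab => ?_, hα_pos⟩
    induction b using Fin.induction with
    | zero => exact absurd hab (Fin.not_lt_zero a)
    | succ b ih =>
      have hb := hα b.castSucc b.succ (by simp)
      rcases (Fin.le_castSucc_iff.2 hab).eq_or_lt with rfl | h
      · exact hb
      · linarith [ih h]
  refine ⟨fun t ht x _ => ?_, isDeltaBoseSolution_halfFlatFormula θ hadm, fun x hx hx0 => ?_⟩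
  · obtain ⟨δ, hδ⟩ := hadm.exists_separated
    exact hδ.integrable_halfFlatIntegrand θ ht x
  · have hx0 : x 0 ≠ 0 := hx0
    rcases lt_or_gt_of_ne hx0 with h | h
    · have hzero : tiltedHalfFlat (n + 1) θ x = 0 :=
        Finset.prod_eq_zero (Finset.mem_univ 0) (by simp [h])
      rw [hzero, ofReal_zero]
      exact tendsto_halfFlatFormula_of_neg θ hadm x h
    · have hpos : ∀ a, 0 < x a := fun a => by
        rcases (Fin.zero_le a).eq_or_lt with rfl | ha
        · exact h
        · exact h.trans (hx 0 a ha)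
      have hval : tiltedHalfFlat (n + 1) θ x = ∏ a, Real.exp (-θ * x a) :=
        Finset.prod_congr rfl fun a _ => by simp [(hpos a).le]
      rw [hval]
      exact tendsto_halfFlatFormula_of_pos θ (n + 1) hadm x hx hpos
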